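/- Strings are finite binary strings, $|x|$ is the length of a string $x$ and $|A|$ the cardinality of a finite set $A$; $\log$ is the binary logarithm. Fix a reference universal machine $U$: for some computable one-to-one pairing of strings $\langle\cdot,\cdot\rangle$ whose length $|\langle u,v\rangle|$ exceeds $|u|+|v|$ by at most an amount depending only on $|u|$, $U$ is a partial computable function of a program and an auxiliary input such that every partial computable $\psi(p,y)$ satisfies $U(\langle i,p\rangle,y)=\psi(p,y)$ for some string $i$ and all $p,y$. Let $C(x\mid y)$ be the length of a shortest $p$ with $U(p,y)=x$, and $C(x)=C(x\mid\epsilon)$. Fix a computable one-to-one coding $\varphi$ of finite sets of strings by strings (for instance a computable bijection, or listing the elements in a fixed order), and for a finite set $A$ of strings and a finite family $\mathcal F$ of such sets let $C(A)=C(\varphi(A))$, $C(x\mid A)=C(x\mid\varphi(A))$ and $C(\mathcal F)=C(\{\varphi(A):A\in\mathcal F\})$. The randomness deficiency of $x\in A$ is $\delta(x\mid A)=\log|A|-C(x\mid A)$. **Theorem.** Let $\mathcal A$ be a distortion family, that is, a set of finite nonempty sets of strings, such that (Property 2) all elements of any one $A\in\mathcal A$ have the same length, and (Property 3) $C(\mathcal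 A_n)=O(\log n)$, where $\mathcal A_n=\{A\in\mathcal A: A\subseteq\{0,1\}^n\}$. Let $x$ be a string of length $n$, let $B\in\mathcal A$ with $x\in B$, and let $A_x$ be a set of minimal complexity $C(A)$ among the sets $A\in\mathcal A$ with $x\in A$ and $\lceil\log|A|\rceil=\lceil\log|B|\rceil$. Then $$C(A_x)+\log|A_x|-C(x)\le\delta(x\mid B)+O(\log C(B)+\log n).$$ Here $O(f)$ means at most $cf+c$ for a constant $c$ (with $\log 0$ read as $0$); the constant in the conclusion depends on $U$, $\varphi$ and $\mathcal A$, but not on $n$, $x$, $B$ or $A_x$. -/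

import Mathlib

/-! Plain Kolmogorov complexity of strings, of finite sets of strings and of finite families of
such sets, and distortion families. -/

namespace RateDistortion

/-- Finite binary strings. -/
abbrev BinStr : Type := List Bool

/-- A computable one-to-one pairing of strings in which the length of `⟨u, v⟩` exceeds
`|u| + |v|` by at most an amount that depends only on `|u|`. -/
structure IsPairing (pair : BinStr → BinStr → BinStr) : Prop where
  computable : Computable₂ pair
  injective : ∀ u v u' v', pair u v = pair u' v' → u = u' ∧ v = v'
  length_le : ∃ f : ℕ → ℕ, ∀ u v, (pair u v).length ≤ u.length + v.length + f u.length

/-- `U p y` is the output, if any, of the machine on program `p` with auxiliary input `y`.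
The machine is universal (a reference machine) when it is partial computable and simulates every
partial computable `ψ`: for some index `i`, it gives on `⟨i, p⟩` and `y` the result `ψ p y`. -/
structure IsUniversalMachine (U : BinStr → BinStr →. BinStr) : Prop where
  partrec : Partrec₂ U
  universal : ∃ pair : BinStr → BinStr → BinStr, IsPairing pair ∧
    ∀ ψ : BinStr → BinStr →. BinStr, Partrec₂ ψ → ∃ i, ∀ p y, U (pair i p) y = ψ p y

/-- Conditional complexity `C(x | y)`: the length of a shortest program that outputs `x` when
given `y` as auxiliary input. -/
noncomputable def condC (U : BinStr → BinStr →. BinStr) (x y : BinStr) : ℕ :=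
  sInf {k | ∃ p : BinStr, p.length = k ∧ x ∈ U p y}

/-- Complexity `C(x) = C(x | ε)`. -/
noncomputable def strC (U : BinStr → BinStr →. BinStr) (x : BinStr) : ℕ :=
  condC U x []

/-- A computable one-to-one coding of finite sets of strings by strings: the code is computable
from any list of the elements of the set. Computable bijections between the finite sets and the
strings are of this kind, and so are the codes that list the elements in a fixed computable
order, suitably separated. -/
structure IsSetCoding (φ : Finset BinStr → BinStr) : Prop where
  injective : Function.Injective φ
  computable : Computable (fun l : List BinStr => φ l.toFinset)

/-- Complexity `C(A)` of a finite set of strings. -/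
noncomputable def setC (U : BinStr → BinStr →. BinStr) (φ : Finset BinStr → BinStr)
    (A : Finset BinStr) : ℕ :=
  strC U (φ A)

/-- Complexity `C(x | A)` of a string given a finite set of strings. -/
noncomputable def condSetC (U : BinStr → BinStr →. BinStr) (φ : Finset BinStr → BinStr)
    (x : BinStr) (A : Finset BinStr) : ℕ :=
  condC U x (φ A)

/-- Complexity of a finite family of finite sets of strings: that of the set of the codes of its
members. -/
noncomputable def familyC (U : BinStr → BinStr →. BinStr) (φ : Finset BinStr → BinStr)
    (F : Finset (Finset BinStr)) : ℕ :=
  setC U φ (F.image φ)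

/-- Randomness deficiency `δ(x | A) = log |A| - C(x | A)`. -/
noncomputable def deficiency (U : BinStr → BinStr →. BinStr) (φ : Finset BinStr → BinStr)
    (x : BinStr) (A : Finset BinStr) : ℝ :=
  Real.logb 2 (A.card : ℝ) - (condSetC U φ x A : ℝ)

/-- A distortion family: a set of finite nonempty sets of strings. -/
def IsDistortionFamily (𝒜 : Set (Finset BinStr)) : Prop :=
  ∀ A ∈ 𝒜, A.Nonempty

/-- The set `{0,1}ⁿ`. -/
noncomputable def cube (n : ℕ) : Finset BinStr :=
  (List.finite_length_eq Bool n).toFinset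

open Classical in
/-- `𝒜ₙ`, the members of `𝒜` that are subsets of `{0,1}ⁿ`. -/
noncomputable def restrict (𝒜 : Set (Finset BinStr)) (n : ℕ) : Finset (Finset BinStr) :=
  (cube n).powerset.filter (fun A => A ∈ 𝒜)

/-- All strings in a member of the family have the same length. -/
def Property2 (𝒜 : Set (Finset BinStr)) : Prop :=
  ∀ A ∈ 𝒜, ∀ x ∈ A, ∀ y ∈ A, x.length = y.length

/-- `C(𝒜ₙ) = O(log n)`, where `O(f)` stands for at most `c * f + c` with a constant `c`. -/
def Property3 (U : BinStr → BinStr →. BinStr) (φ : Finset BinStr → BinStr)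
    (𝒜 : Set (Finset BinStr)) : Prop :=
  ∃ c : ℝ, ∀ n : ℕ, (familyC U φ (restrict 𝒜 n) : ℝ) ≤ c * Real.logb 2 (n : ℝ) + c

/-- `⌈log |A|⌉`. -/
noncomputable def ceilLogCard (A : Finset BinStr) : ℤ :=
  ⌈Real.logb 2 (A.card : ℝ)⌉

/-- `A` has minimal complexity among the members of `𝒜` that contain `x` and have the same
rounded log-cardinality as `B`. -/
def IsMinimalModel (U : BinStr → BinStr →. BinStr) (φ : Finset BinStr → BinStr)
    (𝒜 : Set (Finset BinStr)) (x : BinStr) (B A : Finset BinStr) : Prop :=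
  (A ∈ 𝒜 ∧ x ∈ A ∧ ceilLogCard A = ceilLogCard B) ∧
    ∀ A' ∈ 𝒜, x ∈ A' → ceilLogCard A' = ceilLogCard B → setC U φ A ≤ setC U φ A'

end RateDistortion

/-! Since `A` and `B` have the same rounded log-cardinality, the claim amounts to C(A) + C(x | B) ≤
C(x) up to logarithmic terms. Put k = C(B), q = C(x), and let `K` enumerate the sets of the family
in the cube of dimension n that have the rounded size of `B` and complexity at most k. Let about 2^m
sets of `K` contain x. Three descriptions by position in an enumeration give the bound
(`exists_setC_add_condSetC_le`).

Given `B`, enumerate the strings of complexity at most q for which `B` is among the first 2^(m+1)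
sets of `K` containing them. If there are about 2^h of these, then C(x | B) is at most about h. Each
of the at most 2^(q+1) strings counts for at most 2^(m+1) sets, so double counting leaves at most
2^(q+m+2-h) sets with as many such strings as `B`; hence k is at most about q + m - h.

Finally, x lies in so many sets of `K` that a thinned subfamily still covers it. Cut `K` into blocks
of D = 2^d sets, with d about m - log n, and select at most one set per complete block. A random
choice would cover every string that lies in D(n + 2) sets; a potential function derandomizes it
online (`potential_picks_le`, `exists_mem_picks`), so the selected sets can be enumerated along with
`K`. There are at most 2^(k+1-d) of them and one contains x, so by minimality C(A) is at most about
k - m. Adding up, k, m and h cancel.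

All enumerations need only a program for the family and a few numbers, of logarithmic total length.
A description of this kind is justified once, in `exists_condC_le_of_enum`. -/

namespace RateDistortion

/-! ### Primitive recursive and computable operations on lists. -/

section PrimrecLists

variable {α β σ : Type*} [Primcodable α] [Primcodable β] [Primcodable σ]

theorem primrec_list_filter {f : α → List β} {p : α → β → Bool} (hf : Primrec f)
    (hp : Primrec₂ p) : Primrec fun a => (f a).filter (p a) := by
  have h : Primrec fun a => (f a).filterMap fun b => bif p a b then some b else none :=
    Primrec.listFilterMap hf
      (Primrec.cond hp (Primrec.option_some.comp Primrec.snd) (Primrec.const none))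
  refine h.of_eq fun a => ?_
  rw [← List.filterMap_eq_filter]
  congr 1
  funext b
  cases hb : p a b <;> simp [Option.guard, hb]

theorem primrec_list_any {f : α → List β} {p : α → β → Bool} (hf : Primrec f)
    (hp : Primrec₂ p) : Primrec fun a => (f a).any (p a) := by
  have h : Primrec fun a => decide (0 < ((f a).filter (p a)).length) :=
    (Primrec.nat_lt.comp (Primrec.const 0)
      (Primrec.list_length.comp (primrec_list_filter hf hp))).decide
  refine h.of_eq fun a => ?_
  rw [Bool.eq_iff_iff]
  simp [List.length_pos_iff_exists_mem]

theorem primrecPred_list_mem {f : α → β} {g : α → List β} (hf : Primrec f)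
    (hg : Primrec g) : PrimrecPred fun a => f a ∈ g a := by
  classical
  have h : Primrec fun a => (g a).any fun b => decide (b = f a) :=
    primrec_list_any hg (Primrec.eq.comp Primrec.snd (hf.comp Primrec.fst)).decide
  refine primrecPred_iff_primrec_decide.2 (h.of_eq fun a => ?_)
  rw [Bool.eq_iff_iff]
  simp

theorem primrec_list_sum {f : α → List β} {g : α → β → ℕ} (hf : Primrec f)
    (hg : Primrec₂ g) : Primrec fun a => ((f a).map (g a)).sum := by
  have h : Primrec fun a => ((f a).map (g a)).foldr (fun x s => x + s) 0 :=
    Primrec.list_foldr (h := fun _ (p : ℕ × ℕ) => p.1 + p.2)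
      (Primrec.list_map hf hg) (Primrec.const 0)
      (Primrec.nat_add.comp (Primrec.fst.comp Primrec.snd) (Primrec.snd.comp Primrec.snd))
  exact h.of_eq fun a => rfl

theorem primrec_nat_pow {f g : α → ℕ} (hf : Primrec f) (hg : Primrec g) :
    Primrec fun a => f a ^ g a :=
  (Primrec₂.unpaired'.1 Nat.Primrec.pow : Primrec₂ fun a b : ℕ => a ^ b).comp hf hg

/-- The coding of sets is only assumed computable, so lists of codes cannot be formed by primitive
recursive mapping. -/
theorem computable_list_map {f : α → List β} {g : β → σ} (hf : Computable f)
    (hg : Computable g) : Computable fun a => (f a).map g := by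
  have key : Computable fun a => Nat.rec (motive := fun _ => Option (List σ)) (some [])
      (fun i acc => acc.bind fun l => ((f a)[i]?).map fun b => l ++ [g b]) (f a).length := by
    refine Computable.nat_rec
      (h := fun a (p : ℕ × Option (List σ)) =>
        p.2.bind fun l => ((f a)[p.1]?).map fun b => l ++ [g b])
      (Computable.list_length.comp hf) (Computable.const _) ?_
    refine Computable.option_bind (Computable.snd.comp Computable.snd) ?_
    refine Computable.option_map
      (Computable.list_getElem?.comp (hf.comp (Computable.fst.comp Computable.fst))
        (Computable.fst.comp (Computable.snd.comp Computable.fst))) ?_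
    exact Computable.list_concat.comp (Computable.snd.comp Computable.fst)
      (hg.comp Computable.snd)
  have key2 : Computable fun a => (Nat.rec (motive := fun _ => Option (List σ)) (some [])
      (fun i acc => acc.bind fun l => ((f a)[i]?).map fun b => l ++ [g b])
      (f a).length).getD [] := Computable.option_getD key (Computable.const [])
  refine key2.of_eq fun a => ?_
  have : ∀ i ≤ (f a).length, Nat.rec (motive := fun _ => Option (List σ)) (some [])
      (fun i acc => acc.bind fun l => ((f a)[i]?).map fun b => l ++ [g b]) i
        = some (((f a).take i).map g) := by
    intro i
    induction i with
    | zero => simp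
    | succ i ih =>
      intro hi
      have hlt : i < (f a).length := hi
      simp only [ih hlt.le, Option.bind_some]
      rw [List.getElem?_eq_getElem hlt, List.take_add_one, List.getElem?_eq_getElem hlt]
      simp only [Option.map_some, List.map_append, Option.toList_some, List.map_cons, List.map_nil]
  rw [this _ le_rfl]
  simp

end PrimrecLists

/-! ### Enumerations without repetition. -/

section Accum

variable {α : Type*} [DecidableEq α]

/-- Append `o` to a list, unless it is absent or already listed. -/
def appendNew (l : List α) (o : Option α) : List α :=
  o.elim l fun a => if a ∈ l then l else l ++ [a]

/-- The outputs of `e` before time `t`, in the order of their first appearance. -/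
def accum (e : ℕ → Option α) : ℕ → List α
  | 0 => []
  | t + 1 => appendNew (accum e t) (e t)

theorem prefix_appendNew (l : List α) (o : Option α) : l <+: appendNew l o := by
  cases o with
  | none => exact List.prefix_rfl
  | some a =>
    simp only [appendNew, Option.elim]
    split_ifs
    · exact List.prefix_rfl
    · exact List.prefix_append _ _

theorem accum_prefix (e : ℕ → Option α) {s t : ℕ} (h : s ≤ t) : accum e s <+: accum e t := by
  induction h with
  | refl => exact List.prefix_rfl
  | step _ ih => exact ih.trans (prefix_appendNew _ _)

theorem mem_accum (e : ℕ → Option α) (t : ℕ) (a : α) :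
    a ∈ accum e t ↔ ∃ s < t, e s = some a := by
  induction t with
  | zero => simp [accum]
  | succ t ih =>
    have hstep : a ∈ accum e (t + 1) ↔ a ∈ accum e t ∨ e t = some a := by
      simp only [accum, appendNew]
      cases h : e t with
      | none => simp
      | some b =>
        simp only [Option.elim, Option.some.injEq]
        split_ifs with hb
        · constructor
          · exact Or.inl
          · rintro (h | rfl) <;> assumption
        · simp [eq_comm]
    rw [hstep, ih]
    constructor
    · rintro (⟨s, hs, h⟩ | h)
      · exact ⟨s, by omega, h⟩
      · exact ⟨t, by omega, h⟩
    · rintro ⟨s, hs, h⟩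
      rcases Nat.lt_succ_iff_lt_or_eq.1 hs with h' | rfl
      · exact Or.inl ⟨s, h', h⟩
      · exact Or.inr h

theorem nodup_accum (e : ℕ → Option α) (t : ℕ) : (accum e t).Nodup := by
  induction t with
  | zero => simp [accum]
  | succ t ih =>
    simp only [accum, appendNew]
    cases e t with
    | none => exact ih
    | some b =>
      simp only [Option.elim]
      split_ifs with hb
      · exact ih
      · exact List.nodup_append.2 ⟨ih, by simp, by rintro a ha c hc rfl; simp_all⟩

theorem length_accum_le (e : ℕ → Option α) (T : Finset α)
    (hT : ∀ s a, e s = some a → a ∈ T) (t : ℕ) : (accum e t).length ≤ T.card := by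
  rw [← List.toFinset_card_of_nodup (nodup_accum e t)]
  refine Finset.card_le_card fun a ha => ?_
  obtain ⟨s, -, h⟩ := (mem_accum e t a).1 (List.mem_toFinset.1 ha)
  exact hT s a h

/-- An enumeration of a finite set stabilizes. -/
theorem exists_accum_final (e : ℕ → Option α) (T : Finset α)
    (hT : ∀ s a, e s = some a → a ∈ T) : ∃ t₀, ∀ t, accum e t <+: accum e t₀ := by
  by_contra! h
  -- Without a final stage every stage is properly extended by a later one, so lengths are
  -- unbounded, against the bound by the number of possible outputs.
  have hlong : ∀ N, ∃ t, N ≤ (accum e t).length := by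
    intro N
    induction N with
    | zero => exact ⟨0, Nat.zero_le _⟩
    | succ N ih =>
      obtain ⟨t, ht⟩ := ih
      obtain ⟨t', ht'⟩ := h t
      have htt' : t ≤ t' := by
        by_contra hlt
        exact ht' (accum_prefix e (by omega))
      refine ⟨t', ?_⟩
      by_contra hN
      have hpre := accum_prefix e htt'
      have heq : accum e t = accum e t' := hpre.eq_of_length_le (by omega)
      exact ht' (heq ▸ List.prefix_rfl)
  obtain ⟨t, ht⟩ := hlong (T.card + 1)
  have := length_accum_le e T hT t
  omega

variable {γ : Type*} [Primcodable γ] [Primcodable α]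

theorem primrec_accum {e : γ → ℕ → Option α} (he : Primrec₂ e) :
    Primrec₂ fun c t => accum (e c) t := by
  have happ : Primrec₂ (appendNew : List α → Option α → List α) := by
    have h : Primrec fun p : List α × Option α =>
        (Option.casesOn p.2 p.1 fun a => if a ∈ p.1 then p.1 else p.1 ++ [a] : List α) := by
      refine Primrec.option_casesOn Primrec.snd Primrec.fst ?_
      refine Primrec.ite (c := fun q : (List α × Option α) × α => q.2 ∈ q.1.1) ?_
        (Primrec.fst.comp Primrec.fst)
        (Primrec.list_concat.comp (Primrec.fst.comp Primrec.fst) Primrec.snd)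
      exact primrecPred_list_mem Primrec.snd (Primrec.fst.comp Primrec.fst)
    exact h.of_eq fun p => by rcases p with ⟨l, _ | a⟩ <;> rfl
  have h : Primrec fun p : γ × ℕ => (Nat.rec (motive := fun _ => List α) []
      (fun t l => appendNew l (e p.1 t)) p.2 : List α) :=
    Primrec.nat_rec' (f := fun p : γ × ℕ => p.2) (g := fun _ => ([] : List α))
      (h := fun p (q : ℕ × List α) => appendNew q.2 (e p.1 q.1)) Primrec.snd (Primrec.const [])
      (happ.comp (Primrec.snd.comp Primrec.snd)
        (he.comp (Primrec.fst.comp Primrec.fst) (Primrec.fst.comp Primrec.snd)))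
  refine h.of_eq fun ⟨c, t⟩ => ?_
  induction t with
  | zero => rfl
  | succ t ih => simp only [accum] at ih ⊢; rw [← ih]

end Accum

/-! ### Binary numerals and self-delimiting codes. -/

section Encoding

/-- The natural number with binary digits `u`, lowest digit first. -/
def strToNat (u : BinStr) : ℕ :=
  u.foldr (fun b s => cond b 1 0 + 2 * s) 0

theorem primrec_strToNat : Primrec strToNat :=
  Primrec.list_foldr (f := fun u : BinStr => u) (g := fun _ => 0)
    (h := fun _ (p : Bool × ℕ) => cond p.1 1 0 + 2 * p.2) Primrec.id (Primrec.const 0)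
    (Primrec.nat_add.comp
      (Primrec.cond (Primrec.fst.comp Primrec.snd) (Primrec.const 1) (Primrec.const 0))
      (Primrec.nat_mul.comp (Primrec.const 2) (Primrec.snd.comp Primrec.snd)))

theorem exists_strToNat (s v : ℕ) (h : v < 2 ^ s) : ∃ u, strToNat u = v ∧ u.length = s := by
  induction s generalizing v with
  | zero => exact ⟨[], by simp at h; simp [strToNat, h], rfl⟩
  | succ s ih =>
    obtain ⟨u, hu, hl⟩ := ih (v / 2) (by rw [pow_succ] at h; omega)
    refine ⟨decide (v % 2 = 1) :: u, ?_, by simp [hl]⟩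
    have : strToNat (decide (v % 2 = 1) :: u)
        = cond (decide (v % 2 = 1)) 1 0 + 2 * strToNat u := rfl
    rw [this, hu]
    rcases Nat.mod_two_eq_zero_or_one v with h0 | h0 <;> simp [h0] <;> omega

/-- A self-delimiting code of a string. -/
def selfDelim (u : BinStr) : BinStr :=
  u.flatMap (fun b => [true, b]) ++ [false]

/-- A self-delimiting code of a list of strings. -/
def selfDelimList (us : List BinStr) : BinStr :=
  us.flatMap (fun u => true :: selfDelim u) ++ [false]

theorem primrec_selfDelim : Primrec selfDelim :=
  Primrec.list_concat.comp
    (Primrec.list_flatMap Primrec.id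
      (Primrec.list_cons.comp (Primrec.const true)
        (Primrec.list_cons.comp Primrec.snd (Primrec.const [])))) (Primrec.const false)

theorem primrec_selfDelimList : Primrec selfDelimList :=
  Primrec.list_concat.comp
    (Primrec.list_flatMap Primrec.id
      (Primrec.list_cons.comp (Primrec.const true)
        (primrec_selfDelim.comp Primrec.snd))) (Primrec.const false)

/-- Every digit is announced by `true` and the end by `false`, so a reader knows where the code
stops. The doubled length is harmless, since only short parameters are coded this way. -/
theorem selfDelim_append_inj (u u' r r' : BinStr)
    (h : selfDelim u ++ r = selfDelim u' ++ r') : u = u' ∧ r = r' := by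
  induction u generalizing u' with
  | nil => cases u' <;> simp_all [selfDelim]
  | cons b u ih =>
    cases u' with
    | nil => simp [selfDelim] at h
    | cons b' u' =>
      have h' : b = b' ∧ selfDelim u ++ r = selfDelim u' ++ r' := by
        simpa [selfDelim] using h
      obtain ⟨rfl, h2⟩ := h'
      obtain ⟨rfl, rfl⟩ := ih u' h2
      exact ⟨rfl, rfl⟩

theorem selfDelimList_append_inj (us us' : List BinStr) (r r' : BinStr)
    (h : selfDelimList us ++ r = selfDelimList us' ++ r') : us = us' ∧ r = r' := by
  induction us generalizing us' with
  | nil => cases us' <;> simp_all [selfDelimList]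
  | cons u us ih =>
    cases us' with
    | nil => simp [selfDelimList] at h
    | cons u' us' =>
      have h' : selfDelim u ++ (selfDelimList us ++ r)
          = selfDelim u' ++ (selfDelimList us' ++ r') := by
        simpa [selfDelimList] using h
      obtain ⟨rfl, h2⟩ := selfDelim_append_inj _ _ _ _ h'
      obtain ⟨rfl, rfl⟩ := ih us' h2
      exact ⟨rfl, rfl⟩

theorem length_selfDelim (u : BinStr) : (selfDelim u).length = 2 * u.length + 1 := by
  induction u with
  | nil => rfl
  | cons b u ih => simp [selfDelim] at ih ⊢; omega

theorem length_selfDelimList (us : List BinStr) :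
    (selfDelimList us).length = (us.map fun u => 2 * u.length + 2).sum + 1 := by
  induction us with
  | nil => rfl
  | cons u us ih =>
    have : selfDelimList (u :: us) = true :: selfDelim u ++ selfDelimList us := by
      simp [selfDelimList]
    rw [this]
    simp [ih, length_selfDelim]
    omega

end Encoding

/-! ### Universal machines and descriptions by position in an enumeration. -/

section Machine

/-- Step-bounded evaluation of a partial computable function. -/
theorem exists_primrec_stages {α σ : Type*} [Primcodable α] [Primcodable σ] {f : α →. σ}
    (hf : Partrec f) :
    ∃ V : α → ℕ → Option σ, Primrec₂ V ∧ ∀ a b, b ∈ f a ↔ ∃ t, V a t = some b := by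
  obtain ⟨c, hc⟩ := Nat.Partrec.Code.exists_code.1 hf
  refine ⟨fun a t => (Nat.Partrec.Code.evaln t c (Encodable.encode a)).bind
    (fun m => (Encodable.decode m : Option σ)), ?_, fun a b => ?_⟩
  · exact Primrec.option_bind
      (Nat.Partrec.Code.primrec_evaln.comp
        ((Primrec.snd.pair (Primrec.const c)).pair (Primrec.encode.comp Primrec.fst)))
      (Primrec.decode.comp Primrec.snd)
  · have heval : Nat.Partrec.Code.eval c (Encodable.encode a) = (f a).map Encodable.encode := by
      rw [hc]; simp
    constructor
    · intro hb
      have : Encodable.encode b ∈ Nat.Partrec.Code.eval c (Encodable.encode a) := by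
        rw [heval]; exact Part.mem_map _ hb
      obtain ⟨k, hk⟩ := Nat.Partrec.Code.evaln_complete.1 this
      exact ⟨k, Option.bind_eq_some_iff.2 ⟨_, hk, by simp⟩⟩
    · rintro ⟨t, ht⟩
      obtain ⟨m, hm, hd⟩ := Option.bind_eq_some_iff.1 ht
      have := Nat.Partrec.Code.evaln_sound (Option.mem_def.2 hm)
      rw [heval] at this
      obtain ⟨b', hb', rfl⟩ := (Part.mem_map_iff _).1 this
      simp at hd
      exact hd ▸ hb'

variable {U : BinStr → BinStr →. BinStr}

theorem IsUniversalMachine.exists_program (hU : IsUniversalMachine U) (x y : BinStr) :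
    ∃ p : BinStr, p.length = condC U x y ∧ x ∈ U p y := by
  obtain ⟨pair, -, h⟩ := hU.universal
  obtain ⟨i, hi⟩ := h (fun p _ => Part.some p) (Computable.fst.partrec)
  have hne : {k | ∃ p : BinStr, p.length = k ∧ x ∈ U p y}.Nonempty :=
    ⟨_, pair i x, rfl, by rw [hi]; exact Part.mem_some x⟩
  exact Nat.sInf_mem hne

theorem condC_le {x y p : BinStr} (h : x ∈ U p y) : condC U x y ≤ p.length :=
  Nat.sInf_le ⟨p, rfl, h⟩

/-- Invariance: the overhead of the pairing depends only on the index of `ψ`, hence is a constant.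
-/
theorem IsUniversalMachine.exists_condC_le_length (hU : IsUniversalMachine U)
    {ψ : BinStr → BinStr →. BinStr} (hψ : Partrec₂ ψ) :
    ∃ c : ℕ, ∀ x y p, x ∈ ψ p y → condC U x y ≤ p.length + c := by
  obtain ⟨pair, ⟨-, -, f, hf⟩, h⟩ := hU.universal
  obtain ⟨i, hi⟩ := h ψ hψ
  refine ⟨i.length + f i.length, fun x y p hx => ?_⟩
  have h1 : condC U x y ≤ (pair i p).length := condC_le (by rw [hi]; exact hx)
  have := hf i p
  omega

theorem IsUniversalMachine.exists_strC_le_length (hU : IsUniversalMachine U) :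
    ∃ c : ℕ, ∀ x, strC U x ≤ x.length + c := by
  obtain ⟨c, hc⟩ := hU.exists_condC_le_length (ψ := fun p _ => Part.some p)
    (Computable.fst.partrec)
  exact ⟨c, fun x => hc x [] x (Part.mem_some x)⟩

/-- Splits a program into a self-delimited list of parameters and the rest. -/
def splitProgram (p : BinStr) : Part (List BinStr × BinStr) :=
  Nat.rfindOpt fun m => (Encodable.decode m : Option (List BinStr × BinStr)).bind fun q =>
    if selfDelimList q.1 ++ q.2 = p then some q else none

theorem partrec_splitProgram : Partrec splitProgram := by
  refine Partrec.rfindOpt (Primrec.to_comp ?_)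
  refine Primrec.option_bind (Primrec.decode.comp Primrec.snd) ?_
  refine Primrec.ite ?_ (Primrec.option_some.comp Primrec.snd) (Primrec.const none)
  exact Primrec.eq.comp
    (Primrec.list_append.comp
      (primrec_selfDelimList.comp (Primrec.fst.comp Primrec.snd)) (Primrec.snd.comp Primrec.snd))
    (Primrec.fst.comp Primrec.fst)

theorem mem_splitProgram (us : List BinStr) (r : BinStr) :
    (us, r) ∈ splitProgram (selfDelimList us ++ r) := by
  -- The search halts because the code of `(us, r)` is itself a hit; unique decodability shows that
  -- whatever hit comes first is this pair.
  have hdom : (splitProgram (selfDelimList us ++ r)).Dom :=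
    Nat.rfindOpt_dom.2 ⟨Encodable.encode (us, r), (us, r), by simp⟩
  obtain ⟨q, hq⟩ := Part.dom_iff_mem.1 hdom
  obtain ⟨m, hm⟩ := Nat.rfindOpt_spec hq
  obtain ⟨q', -, hq'⟩ := Option.bind_eq_some_iff.1 (Option.mem_def.1 hm)
  split_ifs at hq' with h
  obtain rfl : q' = q := by simpa using hq'
  obtain ⟨h1, h2⟩ := selfDelimList_append_inj _ _ _ _ h
  rwa [show (us, r) = q' from Prod.ext h1.symm h2.symm]

/-- A member of a set of at most `2 ^ s` strings that can be enumerated from some parameters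
and the auxiliary input is described by the parameters and its number in the enumeration. -/
theorem IsUniversalMachine.exists_condC_le_of_enum (hU : IsUniversalMachine U)
    {ζ : Type*} [Primcodable ζ] {g : List BinStr → BinStr →. ζ} (hg : Partrec₂ g)
    {L : ζ → ℕ → List BinStr} (hL : Primrec₂ L) :
    ∃ c : ℕ, ∀ us y z, z ∈ g us y → ∀ (T : Finset BinStr) (s : ℕ),
      (∀ t, ∀ x ∈ L z t, x ∈ T) → T.card ≤ 2 ^ s → ∀ t, ∀ x ∈ L z t,
        condC U x y ≤ s + (selfDelimList us).length + c := by
  -- Time is unpaired into a stage and a position, so the stages become one stream. Deduplicating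
  -- this stream fixes the number of each output, although the lists `L z t` need not extend one
  -- another.
  let e : ζ → ℕ → Option BinStr := fun z t => (L z t.unpair.1)[t.unpair.2]?
  have he : Primrec₂ e :=
    Primrec.list_getElem?.comp
      (hL.comp Primrec.fst (Primrec.fst.comp (Primrec.unpair.comp Primrec.snd)))
      (Primrec.snd.comp (Primrec.unpair.comp Primrec.snd))
  let ν : ζ × ℕ →. BinStr := fun q => Nat.rfindOpt fun t => (accum (e q.1) t)[q.2]?
  have hν : Partrec ν := by
    refine Partrec.rfindOpt (Primrec.to_comp ?_)
    exact Primrec.list_getElem?.comp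
      ((primrec_accum he).comp (Primrec.fst.comp Primrec.fst) Primrec.snd)
      (Primrec.snd.comp Primrec.fst)
  have hψ : Partrec₂ fun (p y : BinStr) => (splitProgram p).bind fun q =>
      (g q.1 y).bind fun z => ν (z, strToNat q.2) := by
    refine Partrec.bind (partrec_splitProgram.comp Computable.fst) ?_
    refine Partrec.bind
      (hg.comp (Computable.fst.comp Computable.snd) (Computable.snd.comp Computable.fst)) ?_
    exact hν.comp (Computable.snd.pair
      (primrec_strToNat.to_comp.comp (Computable.snd.comp (Computable.snd.comp Computable.fst))))
  obtain ⟨c, hc⟩ := hU.exists_condC_le_length hψ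
  refine ⟨c, fun us y z hz T s hT hcard t x hx => ?_⟩
  have heT : ∀ r a, e z r = some a → a ∈ T := fun r a h =>
    hT _ a (List.mem_of_getElem? h)
  obtain ⟨j, hj⟩ := List.mem_iff_getElem?.1 hx
  have hacc : x ∈ accum (e z) (Nat.pair t j + 1) :=
    (mem_accum _ _ _).2 ⟨Nat.pair t j, by omega, by simp [e, hj]⟩
  obtain ⟨i, hi⟩ := List.mem_iff_getElem?.1 hacc
  -- The position is below the size of `T`, so exactly `s` digits suffice; what precedes them in the
  -- program delimits itself.
  have hilt : i < 2 ^ s :=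
    ((List.getElem?_eq_some_iff.1 hi).1.trans_le (length_accum_le _ T heT _)).trans_le hcard
  obtain ⟨u, hu, hul⟩ := exists_strToNat s i hilt
  have hxν : x ∈ ν (z, i) := by
    refine (Nat.rfindOpt_mono ?_).2 ⟨_, hi⟩
    intro a m n hmn ha
    obtain ⟨l, hl⟩ := accum_prefix (e z) hmn
    obtain ⟨hlt, hget⟩ := List.getElem?_eq_some_iff.1 (Option.mem_def.1 ha)
    rw [Option.mem_def, ← hl, List.getElem?_append_left hlt]
    exact ha
  have := hc x y (selfDelimList us ++ u) (Part.mem_bind (mem_splitProgram us u)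
    (Part.mem_bind hz (by simpa only [hu] using hxν)))
  simp only [List.length_append, hul] at this
  omega

/-- The output of the `t`-th pair of a program of length at most `k` and a number of steps. -/
def outputEvent (V : BinStr → ℕ → Option BinStr) (k t : ℕ) : Option BinStr :=
  (Encodable.decode t : Option (BinStr × ℕ)).bind fun q =>
    if q.1.length ≤ k then V q.1 q.2 else none

/-- The outputs of programs of length at most `k` that appear before stage `t`. -/
def outputs (V : BinStr → ℕ → Option BinStr) (k t : ℕ) : List BinStr :=
  accum (outputEvent V k) t

theorem primrec_outputs {V : BinStr → ℕ → Option BinStr} (hV : Primrec₂ V) :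
    Primrec₂ (outputs V) := by
  refine primrec_accum (e := outputEvent V) ?_
  refine Primrec.option_bind (Primrec.decode.comp Primrec.snd) ?_
  refine Primrec.ite ?_ (hV.comp (Primrec.fst.comp Primrec.snd) (Primrec.snd.comp Primrec.snd))
    (Primrec.const none)
  exact Primrec.nat_le.comp (Primrec.list_length.comp (Primrec.fst.comp Primrec.snd))
    (Primrec.fst.comp Primrec.fst)

theorem card_strings_length_le (k : ℕ) :
    ∃ P : Finset BinStr, (∀ p : BinStr, p.length ≤ k → p ∈ P) ∧ P.card ≤ 2 ^ (k + 1) := by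
  refine ⟨(Finset.range (k + 1)).biUnion fun j =>
    (Finset.univ : Finset (List.Vector Bool j)).image fun v => v.toList, fun p hp => ?_, ?_⟩
  · refine Finset.mem_biUnion.2 ⟨p.length, Finset.mem_range.2 (by omega), ?_⟩
    exact Finset.mem_image.2 ⟨⟨p, rfl⟩, Finset.mem_univ _, rfl⟩
  · refine Finset.card_biUnion_le.trans ?_
    calc _ ≤ ∑ j ∈ Finset.range (k + 1), 2 ^ j := Finset.sum_le_sum fun j _ =>
          Finset.card_image_le.trans (by simp)
      _ ≤ 2 ^ (k + 1) := (Nat.geomSum_lt le_rfl (by simp)).le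

/-- The enumeration of the strings of complexity at most `k` stabilizes, at a list of at most
`2 ^ (k + 1)` strings. -/
theorem exists_outputs_final (hU : IsUniversalMachine U) {V : BinStr → ℕ → Option BinStr}
    (hV : ∀ p v, v ∈ U p [] ↔ ∃ t, V p t = some v) (k : ℕ) :
    ∃ t₀, (∀ t, outputs V k t <+: outputs V k t₀) ∧ (outputs V k t₀).length ≤ 2 ^ (k + 1) ∧
      ∀ v, v ∈ outputs V k t₀ ↔ strC U v ≤ k := by
  classical
  have hev : ∀ t v, outputEvent V k t = some v → ∃ p : BinStr, p.length ≤ k ∧ v ∈ U p [] := by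
    intro t v h
    obtain ⟨q, -, hq⟩ := Option.bind_eq_some_iff.1 h
    split_ifs at hq with hk
    exact ⟨q.1, hk, (hV _ _).2 ⟨_, hq⟩⟩
  obtain ⟨P, hP, hPcard⟩ := card_strings_length_le k
  -- Programs that do not halt are sent to the junk value `[]`; as an image of `P`, the set still
  -- has at most 2^(k+1) elements.
  let T : Finset BinStr := P.image fun p => if h : (U p []).Dom then (U p []).get h else []
  have hT : ∀ t v, outputEvent V k t = some v → v ∈ T := by
    intro t v h
    obtain ⟨p, hp, hv⟩ := hev t v h
    refine Finset.mem_image.2 ⟨p, hP p hp, ?_⟩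
    obtain ⟨hd, rfl⟩ := hv
    simp [hd]
  obtain ⟨t₀, ht₀⟩ := exists_accum_final _ T hT
  refine ⟨t₀, ht₀, (length_accum_le _ T hT t₀).trans (Finset.card_image_le.trans hPcard), ?_⟩
  intro v
  constructor
  · intro hv
    obtain ⟨s, -, hs⟩ := (mem_accum _ _ _).1 hv
    obtain ⟨p, hp, hpv⟩ := hev s v hs
    exact (condC_le hpv).trans hp
  · intro hv
    obtain ⟨p, hp, hpv⟩ := hU.exists_program v []
    obtain ⟨τ, hτ⟩ := (hV _ _).1 hpv
    have hs : outputEvent V k (Encodable.encode (p, τ)) = some v := by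
      have : p.length ≤ k := hp.trans_le hv
      simp [outputEvent, this, hτ]
    exact (ht₀ _).subset ((mem_accum _ _ _).2 ⟨_, Nat.lt_succ_self _, hs⟩)

end Machine

/-- A finite set of strings, given by its code and a list of its elements. -/
abbrev Entry : Type := BinStr × List BinStr

/-! ### Online derandomized choice of a small covering subfamily. -/

section Cover

variable {γ : Type*} [Primcodable γ]

theorem primrec_list_prod {α β : Type*} [Primcodable α] [Primcodable β] {f : α → List β}
    {g : α → β → ℕ} (hf : Primrec f) (hg : Primrec₂ g) :
    Primrec fun a => ((f a).map (g a)).prod := by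
  have h : Primrec fun a => ((f a).map (g a)).foldr (fun x s => x * s) 1 :=
    Primrec.list_foldr (h := fun _ (p : ℕ × ℕ) => p.1 * p.2)
      (Primrec.list_map hf hg) (Primrec.const 1)
      (Primrec.nat_mul.comp (Primrec.fst.comp Primrec.snd) (Primrec.snd.comp Primrec.snd))
  exact h.of_eq fun a => rfl

/-- The weight of `x` grows by the factor `D + 1` with each set that contains it, and by `D` with
the others. -/
def weight (D : ℕ) (h : List Entry) (x : BinStr) : ℕ :=
  (h.map fun A => if x ∈ A.2 then D + 1 else D).prod

/-- The total weight of the elements of `X` outside the sets in `F`. -/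
def potential (D : ℕ) (X : List BinStr) (h F : List Entry) : ℕ :=
  (X.map fun x => if F.any (fun A => x ∈ A.2) then 0 else weight D h x).sum

/-- A choice of one set from each of the first `i` blocks of `D` sets that keeps the potential
small. -/
def picks (D : ℕ) (X : List BinStr) (K : List Entry) : ℕ → List Entry
  | 0 => []
  | i + 1 => (((K.drop (i * D)).take D).filter fun A =>
      potential D X (K.take (i * D + D)) (A :: picks D X K i)
        ≤ X.length * D ^ (i * D + D)).head?.toList ++ picks D X K i

theorem primrec_weight : Primrec fun p : (ℕ × List Entry) × BinStr => weight p.1.1 p.1.2 p.2 := by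
  refine primrec_list_prod (Primrec.snd.comp Primrec.fst) ?_
  refine Primrec.ite ?_ (Primrec.succ.comp (Primrec.fst.comp (Primrec.fst.comp Primrec.fst)))
    (Primrec.fst.comp (Primrec.fst.comp Primrec.fst))
  exact primrecPred_list_mem (Primrec.snd.comp Primrec.fst) (Primrec.snd.comp Primrec.snd)

theorem primrec_any_mem : Primrec fun p : List Entry × BinStr =>
    p.1.any fun A => decide (p.2 ∈ A.2) :=
  primrec_list_any Primrec.fst
    (primrecPred_list_mem (Primrec.snd.comp Primrec.fst) (Primrec.snd.comp Primrec.snd)).decide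

theorem primrec_potential {D : γ → ℕ} {X : γ → List BinStr} {h F : γ → List Entry}
    (hD : Primrec D) (hX : Primrec X) (hh : Primrec h) (hF : Primrec F) :
    Primrec fun c => potential (D c) (X c) (h c) (F c) := by
  refine primrec_list_sum hX ?_
  refine Primrec.ite ?_ (Primrec.const 0)
    (primrec_weight.comp (((hD.comp Primrec.fst).pair (hh.comp Primrec.fst)).pair Primrec.snd))
  exact Primrec.eq.comp
    (primrec_any_mem.comp ((hF.comp Primrec.fst).pair Primrec.snd)) (Primrec.const true)

theorem primrec_picks {D : γ → ℕ} {X : γ → List BinStr} {K : γ → List Entry} {i : γ → ℕ}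
    (hD : Primrec D) (hX : Primrec X) (hK : Primrec K) (hi : Primrec i) :
    Primrec fun c => picks (D c) (X c) (K c) (i c) := by
  have h : Primrec fun c => (Nat.rec (motive := fun _ => List Entry) []
      (fun i F => ((((K c).drop (i * D c)).take (D c)).filter fun A =>
        potential (D c) (X c) ((K c).take (i * D c + D c)) (A :: F)
          ≤ (X c).length * D c ^ (i * D c + D c)).head?.toList ++ F) (i c) : List Entry) := by
    refine Primrec.nat_rec' (h := fun c (q : ℕ × List Entry) =>
      ((((K c).drop (q.1 * D c)).take (D c)).filter fun A =>
        potential (D c) (X c) ((K c).take (q.1 * D c + D c)) (A :: q.2)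
          ≤ (X c).length * D c ^ (q.1 * D c + D c)).head?.toList ++ q.2)
      hi (Primrec.const []) ?_
    refine Primrec.list_append.comp (Primrec.optionToList.comp (Primrec.list_head?.comp ?_))
      (Primrec.snd.comp Primrec.snd)
    have hi' : Primrec fun p : γ × ℕ × List Entry => p.2.1 := Primrec.fst.comp Primrec.snd
    have hD' : Primrec fun p : γ × ℕ × List Entry => D p.1 := hD.comp Primrec.fst
    have hend : Primrec fun p : γ × ℕ × List Entry => p.2.1 * D p.1 + D p.1 :=
      Primrec.nat_add.comp (Primrec.nat_mul.comp hi' hD') hD'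
    refine primrec_list_filter (Primrec.list_take.comp hD'
      (Primrec.list_drop.comp (Primrec.nat_mul.comp hi' hD') (hK.comp Primrec.fst))) ?_
    refine (PrimrecRel.comp Primrec.nat_le (primrec_potential (hD'.comp Primrec.fst)
      ((hX.comp Primrec.fst).comp Primrec.fst)
      ((Primrec.list_take.comp hend (hK.comp Primrec.fst)).comp Primrec.fst)
      (Primrec.list_cons.comp Primrec.snd ((Primrec.snd.comp Primrec.snd).comp Primrec.fst)))
      (Primrec.nat_mul.comp (Primrec.list_length.comp ((hX.comp Primrec.fst).comp Primrec.fst))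
        (primrec_nat_pow (hD'.comp Primrec.fst) (hend.comp Primrec.fst)))).decide
  refine h.of_eq fun c => ?_
  induction i c with
  | zero => rfl
  | succ i ih => simp only [picks] at ih ⊢; rw [← ih]

/-- The choice from a block looks only at the sets up to the end of that block, so it is never
revised when the list grows. This makes the picked sets enumerable. -/
theorem picks_congr {D : ℕ} {X : List BinStr} {K K' : List Entry} (hK : K <+: K') {i : ℕ}
    (hi : i * D ≤ K.length) : picks D X K i = picks D X K' i := by
  obtain ⟨R, rfl⟩ := hK
  induction i with
  | zero => rfl
  | succ i ih =>
    have hi' : i * D + D ≤ K.length := by rwa [Nat.succ_mul] at hi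
    have h1 : ((K ++ R).drop (i * D)).take D = (K.drop (i * D)).take D := by
      rw [List.drop_append_of_le_length (by omega),
        List.take_append_of_le_length (by rw [List.length_drop]; omega)]
    simp only [picks]
    rw [ih (by omega), h1, List.take_append_of_le_length hi']

theorem picks_subset_of_le {D : ℕ} {X : List BinStr} {K : List Entry} {i j : ℕ} (h : i ≤ j) :
    picks D X K i ⊆ picks D X K j := by
  induction h with
  | refl => exact List.Subset.refl _
  | step _ ih => exact fun A hA => List.mem_append_right _ (ih hA)

theorem length_picks_le (D : ℕ) (X : List BinStr) (K : List Entry) (i : ℕ) :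
    (picks D X K i).length ≤ i := by
  induction i with
  | zero => simp [picks]
  | succ i ih =>
    have (o : Option Entry) : o.toList.length ≤ 1 := by cases o <;> simp
    simp only [picks, List.length_append]
    have := this (((K.drop (i * D)).take D).filter fun A =>
      potential D X (K.take (i * D + D)) (A :: picks D X K i)
        ≤ X.length * D ^ (i * D + D)).head?
    omega

theorem picks_subset (D : ℕ) (X : List BinStr) (K : List Entry) (i : ℕ) :
    picks D X K i ⊆ K := by
  induction i with
  | zero => simp [picks]
  | succ i ih =>
    intro A hA
    rcases List.mem_append.1 hA with h | h
    · have := List.mem_of_mem_head? (Option.mem_toList.1 h)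
      exact List.mem_of_mem_drop (List.mem_of_mem_take (List.mem_of_mem_filter this))
    · exact ih h

theorem weight_append (D : ℕ) (h h' : List Entry) (x : BinStr) :
    weight D (h ++ h') x = weight D h x * weight D h' x := by
  simp [weight]

theorem weight_eq (D : ℕ) (h : List Entry) (x : BinStr) :
    weight D h x = (D + 1) ^ (h.countP fun A => x ∈ A.2) * D ^ (h.countP fun A => x ∉ A.2) := by
  induction h with
  | nil => simp [weight]
  | cons A h ih =>
    have : weight D (A :: h) x = (if x ∈ A.2 then D + 1 else D) * weight D h x := by simp [weight]
    rw [this, ih]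
    by_cases hx : x ∈ A.2 <;> simp [hx, pow_succ] <;> ring

theorem countP_mem_add_countP_notMem (h : List Entry) (x : BinStr) :
    (h.countP fun A => x ∈ A.2) + (h.countP fun A => x ∉ A.2) = h.length := by
  induction h with
  | nil => simp
  | cons A h ih => by_cases hx : x ∈ A.2 <;> simp [hx] <;> simp at ih <;> omega

/-- This is (1 + 1/D)^c (1 - c/D) ≤ 1 without fractions. Each step of the induction trades a unit of
`e` for one of `c`, and (D + 1)e ≤ D(e + 1) because e ≤ D. -/
theorem succ_pow_mul_le (D c e : ℕ) (h : c + e = D) : (D + 1) ^ c * e ≤ D ^ (c + 1) := by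
  induction c generalizing e with
  | zero => simp; omega
  | succ c ih =>
    have h1 := ih (e + 1) (by omega)
    have h2 : (D + 1) * e ≤ D * (e + 1) := by nlinarith
    calc (D + 1) ^ (c + 1) * e = (D + 1) ^ c * ((D + 1) * e) := by ring
      _ ≤ (D + 1) ^ c * (D * (e + 1)) := Nat.mul_le_mul_left _ h2
      _ = D * ((D + 1) ^ c * (e + 1)) := by ring
      _ ≤ D * D ^ (c + 1) := Nat.mul_le_mul_left _ h1
      _ = D ^ (c + 1 + 1) := by ring

/-- A uniformly chosen set of the block misses `x` with probability e/D, where e counts the sets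
without `x`. The bound says that the growth of the weight over the block, times this probability, is
at most D^D. -/
theorem weight_mul_countP_le {D : ℕ} {b : List Entry} (hb : b.length = D) (x : BinStr) :
    weight D b x * (b.countP fun A => x ∉ A.2) ≤ D ^ D * D := by
  have h := countP_mem_add_countP_notMem b x
  rw [weight_eq]
  set c := b.countP fun A => x ∈ A.2
  set e := b.countP fun A => x ∉ A.2
  have h1 := succ_pow_mul_le D c e (by omega)
  calc (D + 1) ^ c * D ^ e * e = D ^ e * ((D + 1) ^ c * e) := by ring
    _ ≤ D ^ e * D ^ (c + 1) := Nat.mul_le_mul_left _ h1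
    _ = D ^ (c + e) * D := by ring
    _ = D ^ D * D := by rw [h, hb]

theorem sum_map_sum_map_comm {α β : Type*} (l : List α) (m : List β) (f : α → β → ℕ) :
    (l.map fun a => (m.map (f a)).sum).sum = (m.map fun b => (l.map fun a => f a b).sum).sum := by
  induction l with
  | nil => simp
  | cons a l ih => simp [ih, List.sum_map_add]

theorem sum_map_ite_const {α : Type*} (l : List α) (p : α → Prop) [DecidablePred p] (w : ℕ) :
    (l.map fun a => if p a then 0 else w).sum = w * l.countP fun a => ¬ p a := by
  induction l with
  | nil => simp
  | cons a l ih =>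
    by_cases h : p a
    · simp [h, ih]
    · simp [h, ih]; ring

/-- The average over the choices in a block: after exchanging the sums, covered strings contribute
nothing and each other string is bounded by `weight_mul_countP_le`. -/
theorem sum_potential_le {D : ℕ} (X : List BinStr) (h F : List Entry) {b : List Entry}
    (hb : b.length = D) :
    (b.map fun A => potential D X (h ++ b) (A :: F)).sum
      ≤ D * (D ^ D * potential D X h F) := by
  simp only [potential]
  rw [sum_map_sum_map_comm, ← List.sum_map_mul_left, ← List.sum_map_mul_left]
  refine List.sum_le_sum fun x _ => ?_
  by_cases hx : F.any fun A => x ∈ A.2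
  · simp [hx]
  · have : ∀ A : Entry, (if ((A :: F).any fun A => decide (x ∈ A.2)) = true then 0
        else weight D (h ++ b) x) = if x ∈ A.2 then 0 else weight D (h ++ b) x := by
      intro A
      simp only [List.any_cons, Bool.or_eq_true, hx, decide_eq_true_eq]
      simp
    simp only [this, if_neg hx]
    rw [sum_map_ite_const, weight_append]
    have := weight_mul_countP_le hb x
    calc _ = weight D h x * (weight D b x * b.countP fun A => x ∉ A.2) := by ring
      _ ≤ weight D h x * (D ^ D * D) := Nat.mul_le_mul_left _ this
      _ = _ := by ring

/-- The method of conditional expectations: some set of the block does no worse than the average, so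
the filter in `picks` finds a candidate in every complete block. -/
theorem potential_picks_le {D : ℕ} (hD : 0 < D) (X : List BinStr) (K : List Entry) (i : ℕ)
    (hi : i * D ≤ K.length) :
    potential D X (K.take (i * D)) (picks D X K i) ≤ X.length * D ^ (i * D) := by
  induction i with
  | zero => simp [potential, picks, weight]
  | succ i ih =>
    rw [Nat.succ_mul] at hi ⊢
    have ih := ih (by omega)
    set b := (K.drop (i * D)).take D with hbdef
    have hb : b.length = D := by simp only [hbdef, List.length_take, List.length_drop]; omega
    have htake : K.take (i * D + D) = K.take (i * D) ++ b := List.take_add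
    have hex : ∃ A ∈ b, potential D X (K.take (i * D + D)) (A :: picks D X K i)
        ≤ X.length * D ^ (i * D + D) := by
      refine List.exists_le_of_sum_le
        (f := fun A => potential D X (K.take (i * D + D)) (A :: picks D X K i))
        (g := fun _ => X.length * D ^ (i * D + D))
        (List.ne_nil_of_length_pos (l := b) (by omega)) ?_
      rw [htake]
      refine (sum_potential_le X _ _ hb).trans ?_
      simp only [List.map_const', List.sum_replicate, hb, smul_eq_mul]
      refine Nat.mul_le_mul_left _ ?_
      calc _ ≤ D ^ D * (X.length * D ^ (i * D)) := Nat.mul_le_mul_left _ ih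
        _ = _ := by ring
    simp only [picks]
    rw [← hbdef]
    set good := b.filter fun A => potential D X (K.take (i * D + D)) (A :: picks D X K i)
        ≤ X.length * D ^ (i * D + D) with hgood
    cases hh : good with
    | nil =>
      obtain ⟨A, hA, hA'⟩ := hex
      have : A ∈ good := List.mem_filter.2 ⟨hA, by simpa using hA'⟩
      simp [hh] at this
    | cons A l =>
      have : A ∈ good := by simp [hh]
      simpa using (List.mem_filter.1 this).2

/-- One set from each block of `D` sets is enough to cover the elements of `X` that belong to
many of the sets. -/
theorem exists_mem_picks {D n : ℕ} (hD : 0 < D) {X : List BinStr} (hX : X.length = 2 ^ n)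
    (K : List Entry) {x : BinStr} (hxX : x ∈ X)
    (hx : D * (n + 2) ≤ K.countP fun A => x ∈ A.2) :
    ∃ A ∈ picks D X K (K.length / D), x ∈ A.2 := by
  by_contra! hcon
  set I := K.length / D
  have hI : I * D ≤ K.length := Nat.div_mul_le_self _ _
  have hpot := potential_picks_le hD X K I hI
  -- An uncovered string contributes its whole weight to the potential, so this weight is at most
  -- the bound on the total.
  have hw : weight D (K.take (I * D)) x ≤ 2 ^ n * D ^ (I * D) := by
    rw [← hX]
    refine le_trans ?_ hpot
    refine List.single_le_sum (by simp) _ (List.mem_map.2 ⟨x, hxX, ?_⟩)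
    rw [if_neg]
    simpa using fun a b hab => hcon (a, b) hab
  have hcount := countP_mem_add_countP_notMem (K.take (I * D)) x
  have hlen : (K.take (I * D)).length = I * D := by simp [hI]
  have hsplit : (K.countP fun A => x ∈ A.2) = ((K.take (I * D)).countP fun A => x ∈ A.2)
      + (K.drop (I * D)).countP fun A => x ∈ A.2 := by
    rw [← List.countP_append, List.take_append_drop]
  -- The incomplete last block is not used. It can hide fewer than `D` sets containing `x`, which is
  -- why n + 2 is assumed where n + 1 is needed.
  have hdrop : ((K.drop (I * D)).countP fun A => x ∈ A.2) < D := by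
    refine List.countP_le_length.trans_lt ?_
    have := Nat.lt_div_mul_add (a := K.length) hD
    rw [List.length_drop]
    change K.length < I * D + D at this
    omega
  rw [weight_eq] at hw
  set c := (K.take (I * D)).countP fun A => x ∈ A.2
  set e := (K.take (I * D)).countP fun A => x ∉ A.2
  have hc : D * (n + 1) ≤ c := by
    have : D * (n + 2) = D * (n + 1) + D := by ring
    omega
  rw [← hlen, ← hcount, pow_add, ← mul_assoc] at hw
  have hw' : (D + 1) ^ c ≤ 2 ^ n * D ^ c := Nat.le_of_mul_le_mul_right hw (by positivity)
  -- By Bernoulli (1 + 1/D)^D ≥ 2, so D(n + 1) sets containing `x` raise its relative weight to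
  -- 2^(n+1), beyond the 2^n allowed.
  have hbern : 2 * D ^ D ≤ (D + 1) ^ D := by
    have h := one_add_mul_le_pow (a := (1 / D : ℝ)) (by
      have : (0 : ℝ) ≤ 1 / D := by positivity
      linarith) D
    have hD' : (0 : ℝ) < D := by exact_mod_cast hD
    have h1 : (1 + 1 / D : ℝ) ^ D * (D : ℝ) ^ D = (D + 1) ^ D := by
      rw [← mul_pow]; congr 1; field_simp
    have h2 : (2 : ℝ) ≤ (1 + 1 / D) ^ D := by
      have : (D : ℝ) * (1 / D) = 1 := by field_simp
      linarith
    have h3 : (2 : ℝ) * (D : ℝ) ^ D ≤ (D + 1) ^ D := by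
      rw [← h1]; exact mul_le_mul_of_nonneg_right h2 (by positivity)
    exact_mod_cast h3
  obtain ⟨r, hr⟩ := Nat.exists_eq_add_of_le hc
  have h1 : 2 ^ (n + 1) * D ^ c ≤ (D + 1) ^ c := by
    rw [hr, pow_add D, pow_add (D + 1), pow_mul, pow_mul, ← mul_assoc, ← mul_pow]
    exact Nat.mul_le_mul (Nat.pow_le_pow_left hbern _) (Nat.pow_le_pow_left (by omega) _)
  have h2 : 0 < D ^ c := by positivity
  have h3 : 0 < 2 ^ n * D ^ c := by positivity
  rw [pow_succ] at h1
  nlinarith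

end Cover

/-! ### Early members and double counting. -/

section Neighbours

/-- The strings in the list `S` for which `v` is the code of one of the first `M` sets in the
list `K` that contain the string. -/
def earlyMembers (K : List Entry) (S : List BinStr) (M : ℕ) (v : BinStr) : List BinStr :=
  S.filter fun x => ((K.filter fun A => x ∈ A.2).take M).any fun A => A.1 = v

theorem primrec_earlyMembers {γ : Type*} [Primcodable γ] {K : γ → List Entry}
    {S : γ → List BinStr} {M : γ → ℕ} {v : γ → BinStr} (hK : Primrec K) (hS : Primrec S)
    (hM : Primrec M) (hv : Primrec v) :
    Primrec fun c => earlyMembers (K c) (S c) (M c) (v c) := by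
  refine primrec_list_filter hS ?_
  refine primrec_list_any (Primrec.list_take.comp (hM.comp Primrec.fst) ?_) ?_
  · exact primrec_list_filter (hK.comp Primrec.fst)
      (primrecPred_list_mem (Primrec.snd.comp Primrec.fst) (Primrec.snd.comp Primrec.snd)).decide
  · exact (Primrec.eq.comp (Primrec.fst.comp Primrec.snd)
      ((hv.comp Primrec.fst).comp Primrec.fst)).decide

/-- Sets appended to `K` cannot displace earlier ones from the first `M` that contain a string, so
early members are never lost and can be enumerated. -/
theorem earlyMembers_sublist {K K' : List Entry} {S S' : List BinStr} (hK : K <+: K')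
    (hS : S <+: S') (M : ℕ) (v : BinStr) :
    (earlyMembers K S M v).Sublist (earlyMembers K' S' M v) := by
  have h1 : (earlyMembers K S M v).Sublist (earlyMembers K S' M v) := hS.sublist.filter _
  refine h1.trans (List.monotone_filter_right S' fun x hx => ?_)
  obtain ⟨A, hA, hAv⟩ := List.any_eq_true.1 hx
  exact List.any_eq_true.2 ⟨A, ((hK.filter _).take M).subset hA, hAv⟩

theorem length_earlyMembers_eq (K : List Entry) (S : List BinStr) (M : ℕ) (v : BinStr) :
    (earlyMembers K S M v).length = (S.map fun x =>
      if ((K.filter fun A => x ∈ A.2).take M).any (fun A => A.1 = v) then 1 else 0).sum := by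
  induction S with
  | nil => simp [earlyMembers]
  | cons x S ih =>
    simp only [earlyMembers] at ih ⊢
    rw [List.filter_cons, List.map_cons, List.sum_cons, ← ih]
    split_ifs <;> simp [add_comm]

/-- Double counting: few codes have many early members. -/
theorem card_mul_le_of_le_length_earlyMembers (K : List Entry) (S : List BinStr) (M H : ℕ)
    (T : Finset BinStr) (hT : ∀ v ∈ T, H ≤ (earlyMembers K S M v).length) :
    T.card * H ≤ S.length * M := by
  calc T.card * H ≤ ∑ v ∈ T, (earlyMembers K S M v).length := by
        simpa using Finset.card_nsmul_le_sum T _ H hT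
    _ = (S.map fun x => ∑ v ∈ T,
          if ((K.filter fun A => x ∈ A.2).take M).any (fun A => A.1 = v) then 1 else 0).sum := by
        simp only [length_earlyMembers_eq]
        clear hT
        induction S with
        | nil => simp
        | cons x S ih => simp only [List.map_cons, List.sum_cons, Finset.sum_add_distrib, ih]
    _ ≤ (S.map fun _ => M).sum := by
        -- The cutoff bounds the codes charged to a string by `M`, however many sets contain it.
        refine List.sum_le_sum fun x _ => ?_
        set l := (K.filter fun A => x ∈ A.2).take M
        rw [← Finset.card_filter]
        have hsub : (T.filter fun v => l.any (fun A => A.1 = v) = true)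
            ⊆ (l.map Prod.fst).toFinset := by
          intro v hv
          obtain ⟨A, hA, hAv⟩ := List.any_eq_true.1 (Finset.mem_filter.1 hv).2
          exact List.mem_toFinset.2 (List.mem_map.2 ⟨A, hA, by simpa using hAv⟩)
        refine (Finset.card_le_card hsub).trans ((List.toFinset_card_le _).trans ?_)
        rw [List.length_map]; exact List.length_take_le M _
    _ = S.length * M := by simp

end Neighbours

/-! ### Strings of a fixed length and sets of a fixed rounded size. -/

section Classes

/-- The strings of length `n`. -/
def cubeList : ℕ → List BinStr
  | 0 => [[]]
  | n + 1 => (cubeList n).flatMap fun u => [true :: u, false :: u]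

theorem primrec_cubeList : Primrec cubeList := by
  have h : Primrec fun n : ℕ => (Nat.rec (motive := fun _ => List BinStr) [[]]
      (fun _ l => l.flatMap fun u => [true :: u, false :: u]) n : List BinStr) := by
    refine Primrec.nat_rec' (h := fun _ (q : ℕ × List BinStr) =>
      q.2.flatMap fun u => [true :: u, false :: u]) Primrec.id (Primrec.const [[]]) ?_
    exact Primrec.list_flatMap (Primrec.snd.comp Primrec.snd)
      (Primrec.list_cons.comp (Primrec.list_cons.comp (Primrec.const true) Primrec.snd)
        (Primrec.list_cons.comp (Primrec.list_cons.comp (Primrec.const false) Primrec.snd)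
          (Primrec.const [])))
  refine h.of_eq fun n => ?_
  induction n with
  | zero => rfl
  | succ n ih => simp only [cubeList] at ih ⊢; rw [← ih]

theorem length_cubeList (n : ℕ) : (cubeList n).length = 2 ^ n := by
  induction n with
  | zero => rfl
  | succ n ih => simp [cubeList, List.length_flatMap, ih, pow_succ]

theorem mem_cubeList (n : ℕ) (x : BinStr) : x ∈ cubeList n ↔ x.length = n := by
  induction n generalizing x with
  | zero => simp [cubeList]
  | succ n ih =>
    simp only [cubeList, List.mem_flatMap, ih]
    rcases x with _ | ⟨_ | _, x⟩ <;> simp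

theorem nodup_cubeList (n : ℕ) : (cubeList n).Nodup := by
  refine Multiset.coe_nodup.1 (Multiset.toFinset_card_eq_card_iff_nodup.1 ?_)
  change (cubeList n).toFinset.card = (cubeList n).length
  rw [length_cubeList]
  have : (cubeList n).toFinset
      = (Finset.univ : Finset (List.Vector Bool n)).image fun v => v.toList := by
    ext x
    simp only [List.mem_toFinset, mem_cubeList, Finset.mem_image, Finset.mem_univ, true_and]
    exact ⟨fun h => ⟨⟨x, h⟩, rfl⟩, by rintro ⟨v, rfl⟩; simp⟩
  rw [this, Finset.card_image_of_injective _ List.Vector.toList_injective]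
  simp

/-- The number of strings of length `n` in a set. -/
def cardIn (n : ℕ) (A : Entry) : ℕ :=
  ((cubeList n).filter fun x => x ∈ A.2).length

/-- The list of an entry may repeat strings; counting over the cube ignores repetitions. -/
theorem cardIn_eq {n : ℕ} {A : Entry} (h : ∀ x ∈ A.2, x.length = n) :
    cardIn n A = A.2.toFinset.card := by
  rw [cardIn, ← List.toFinset_card_of_nodup ((nodup_cubeList n).filter _)]
  congr 1
  ext x
  simp only [List.mem_toFinset, List.mem_filter, mem_cubeList, decide_eq_true_eq]
  exact ⟨And.right, fun hx => ⟨h x hx, hx⟩⟩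

/-- The entry of a table with a given code and about `2 ^ l` elements, if there is one. -/
def lookup (T : List Entry) (n l : ℕ) (v : BinStr) : Option Entry :=
  (T.filter fun A => A.1 = v ∧ cardIn n A ≤ 2 ^ l ∧ 2 ^ l < 2 * cardIn n A).head?

theorem primrec_lookup {γ : Type*} [Primcodable γ] {T : γ → List Entry} {n l : γ → ℕ}
    {v : γ → BinStr} (hT : Primrec T) (hn : Primrec n) (hl : Primrec l) (hv : Primrec v) :
    Primrec fun c => lookup (T c) (n c) (l c) (v c) := by
  refine Primrec.list_head?.comp (primrec_list_filter hT ?_)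
  have hcard : Primrec fun p : γ × Entry => cardIn (n p.1) p.2 :=
    Primrec.list_length.comp (primrec_list_filter
      (primrec_cubeList.comp (hn.comp Primrec.fst))
      (primrecPred_list_mem Primrec.snd (Primrec.snd.comp (Primrec.snd.comp Primrec.fst))).decide)
  have hpow : Primrec fun p : γ × Entry => 2 ^ l p.1 :=
    primrec_nat_pow (Primrec.const 2) (hl.comp Primrec.fst)
  exact ((Primrec.eq.comp (Primrec.fst.comp Primrec.snd) (hv.comp Primrec.fst)).and
    ((PrimrecRel.comp Primrec.nat_le hcard hpow).and
      (PrimrecRel.comp Primrec.nat_lt hpow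
        (Primrec.nat_mul.comp (Primrec.const 2) hcard)))).decide

theorem lookup_eq_some {T : List Entry} {n l : ℕ} {v : BinStr} {A : Entry}
    (h : lookup T n l v = some A) :
    A ∈ T ∧ A.1 = v ∧ cardIn n A ≤ 2 ^ l ∧ 2 ^ l < 2 * cardIn n A := by
  have := List.mem_filter.1 (List.mem_of_mem_head? (Option.mem_def.2 h))
  simpa using this

theorem exists_lookup_eq_some {T : List Entry} {n l : ℕ} {A : Entry} (hA : A ∈ T)
    (h1 : cardIn n A ≤ 2 ^ l) (h2 : 2 ^ l < 2 * cardIn n A) :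
    ∃ A', lookup T n l A.1 = some A' := by
  have : A ∈ T.filter fun A' => A'.1 = A.1 ∧ cardIn n A' ≤ 2 ^ l ∧ 2 ^ l < 2 * cardIn n A' :=
    List.mem_filter.2 ⟨hA, by simp [h1, h2]⟩
  unfold lookup
  cases hl : T.filter fun A' => A'.1 = A.1 ∧ cardIn n A' ≤ 2 ^ l ∧ 2 ^ l < 2 * cardIn n A' with
  | nil => rw [hl] at this; simp at this
  | cons a _ => exact ⟨a, rfl⟩

/-- Turns the rounded logarithm into the integer inequalities that `lookup` tests. Doubling the
cardinality avoids the exponent l - 1, so l = 0 needs no exception. -/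
theorem ceilLogCard_eq_iff {A : Finset BinStr} (hA : A.Nonempty) (l : ℕ) :
    ceilLogCard A = l ↔ A.card ≤ 2 ^ l ∧ 2 ^ l < 2 * A.card := by
  have hpos := hA.card_pos
  have : ceilLogCard A = (Nat.clog 2 A.card : ℕ) := by
    have := Real.ceil_logb_natCast (b := 2) (r := (A.card : ℝ)) (by positivity)
    rw [Int.clog_natCast] at this
    exact_mod_cast this
  rw [this, Nat.cast_inj]
  constructor
  · rintro rfl
    refine ⟨Nat.le_pow_clog (by norm_num) _, ?_⟩
    rcases Nat.lt_or_ge 1 A.card with h | h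
    · have h1 := Nat.pow_pred_clog_lt_self (b := 2) (by norm_num) h
      have h2 : 0 < Nat.clog 2 A.card := Nat.clog_pos (by norm_num) h
      obtain ⟨j, hj⟩ : ∃ j, Nat.clog 2 A.card = j + 1 := ⟨_, (Nat.succ_pred_eq_of_pos h2).symm⟩
      rw [hj] at h1 ⊢
      rw [pow_succ]
      simp at h1
      omega
    · have : A.card = 1 := by omega
      simp [this]
  · rintro ⟨h1, h2⟩
    refine le_antisymm ((Nat.clog_le_iff_le_pow (by norm_num)).2 h1) ?_
    by_contra! hlt
    have h3 : A.card ≤ 2 ^ Nat.clog 2 A.card := Nat.le_pow_clog (by norm_num) _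
    have h4 : 2 ^ (Nat.clog 2 A.card + 1) ≤ 2 ^ l := Nat.pow_le_pow_right (by norm_num) hlt
    rw [pow_succ] at h4
    omega

end Classes

theorem mem_restrict {𝒜 : Set (Finset BinStr)} {n : ℕ} {D : Finset BinStr} :
    D ∈ restrict 𝒜 n ↔ (∀ y ∈ D, y.length = n) ∧ D ∈ 𝒜 := by
  classical
  simp [restrict, cube, Finset.subset_iff]

/-! ### Recovering the family from its code. -/

section Tables

/-- A list of the members of a finite family of finite sets, with their codes, found from the code
of the set of their codes. -/
def findTable (φ : Finset BinStr → BinStr) (w : BinStr) : Part (List Entry) :=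
  Nat.rfindOpt fun j => (Encodable.decode j : Option (List (List BinStr))).bind fun W =>
    bif decide (φ (W.map fun A => φ A.toFinset).toFinset = w) then
      some (W.map fun A => (φ A.toFinset, A)) else none

theorem partrec_findTable {φ : Finset BinStr → BinStr} (hφ : IsSetCoding φ) :
    Partrec (findTable φ) := by
  refine Partrec.rfindOpt ?_
  refine Computable.option_bind (Computable.decode.comp Computable.snd) ?_
  refine Computable.cond ?_ ?_ (Computable.const none)
  · exact Primrec.eq.decide.to_comp.comp
      (hφ.computable.comp (computable_list_map Computable.snd hφ.computable))
      (Computable.fst.comp Computable.fst)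
  · exact Computable.option_some.comp (computable_list_map Computable.snd
      (hφ.computable.pair Computable.id))

/-- `T` lists the members of `F` with their codes. -/
structure IsTable (φ : Finset BinStr → BinStr) (F : Finset (Finset BinStr)) (T : List Entry) :
    Prop where
  code_eq : ∀ A ∈ T, A.1 = φ A.2.toFinset
  mem_family : ∀ A ∈ T, A.2.toFinset ∈ F
  exists_mem : ∀ B ∈ F, ∃ A ∈ T, A.2.toFinset = B

theorem exists_findTable {φ : Finset BinStr → BinStr} (hφ : IsSetCoding φ)
    (F : Finset (Finset BinStr)) : ∃ T ∈ findTable φ (φ (F.image φ)), IsTable φ F T := by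
  have hdom : (findTable φ (φ (F.image φ))).Dom := by
    let W : List (List BinStr) := F.toList.map Finset.toList
    refine Nat.rfindOpt_dom.2 ⟨Encodable.encode W, W.map fun A => (φ A.toFinset, A), ?_⟩
    have : (W.map fun A => φ A.toFinset).toFinset = F.image φ := by
      ext v; simp [W]
    simp [this]
  obtain ⟨T, hT⟩ := Part.dom_iff_mem.1 hdom
  refine ⟨T, hT, ?_⟩
  obtain ⟨j, hj⟩ := Nat.rfindOpt_spec hT
  obtain ⟨W, -, hW⟩ := Option.bind_eq_some_iff.1 (Option.mem_def.1 hj)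
  by_cases h : φ (W.map fun A => φ A.toFinset).toFinset = φ (F.image φ)
  · simp only [h, decide_true, cond_true, Option.some.injEq] at hW
    -- The search may stop at any list of sets with the right code. Injectivity is used first for
    -- the set of codes and then for each code, so every hit is a table.
    have himage := hφ.injective h
    subst hW
    refine ⟨?_, ?_, ?_⟩
    · simp
    · intro A hA
      obtain ⟨A', hA', rfl⟩ := List.mem_map.1 hA
      have : φ A'.toFinset ∈ F.image φ := by
        rw [← himage]; exact List.mem_toFinset.2 (List.mem_map_of_mem hA')
      obtain ⟨B, hB, hBA⟩ := Finset.mem_image.1 this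
      exact hφ.injective hBA ▸ hB
    · intro B hB
      have : φ B ∈ (W.map fun A => φ A.toFinset).toFinset := by
        rw [himage]; exact Finset.mem_image_of_mem φ hB
      obtain ⟨A, hA, hAB⟩ := List.mem_map.1 (List.mem_toFinset.1 this)
      exact ⟨(φ A.toFinset, A), List.mem_map.2 ⟨A, hA, rfl⟩, hφ.injective hAB⟩
  · simp [h] at hW

end Tables

/-! ### The three descriptions and their combination. -/

section Descriptions

/-- Shortest binary digits of a natural number. -/
noncomputable def binDigits (v : ℕ) : BinStr :=
  (exists_strToNat v.size v (Nat.lt_size_self v)).choose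

theorem strToNat_binDigits (v : ℕ) : strToNat (binDigits v) = v :=
  (exists_strToNat v.size v (Nat.lt_size_self v)).choose_spec.1

theorem length_binDigits (v : ℕ) : (binDigits v).length = v.size :=
  (exists_strToNat v.size v (Nat.lt_size_self v)).choose_spec.2

/-- Parameters, an auxiliary input and a table. -/
abbrev Context : Type := (List BinStr × BinStr) × List Entry

/-- The `i`-th parameter, as a number. -/
def contextParam (z : Context) (i : ℕ) : ℕ :=
  strToNat (z.1.1.getD i [])

theorem primrec_param (i : ℕ) : Primrec fun z : Context => contextParam z i :=
  primrec_strToNat.comp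
    ((Primrec.list_getD []).comp (Primrec.fst.comp Primrec.fst) (Primrec.const i))

/-- The context in which the table is computed with the program that is the first parameter. -/
def context (U : BinStr → BinStr →. BinStr) (φ : Finset BinStr → BinStr)
    (us : List BinStr) (y : BinStr) : Part Context :=
  (U (us.getD 0 []) []).bind fun w => (findTable φ w).map fun T => ((us, y), T)

theorem partrec_context {U : BinStr → BinStr →. BinStr} (hU : IsUniversalMachine U)
    {φ : Finset BinStr → BinStr} (hφ : IsSetCoding φ) : Partrec₂ (context U φ) := by
  refine Partrec.bind (hU.partrec.comp
    ((Primrec.list_getD ([] : BinStr)).to_comp.comp Computable.fst (Computable.const 0))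
    (Computable.const [])) ?_
  refine Partrec.map ((partrec_findTable hφ).comp Computable.snd) ?_
  exact (Computable.fst.comp Computable.fst).pair Computable.snd

/-- The sets in the table of about `2 ^ l` strings of length `n` and of complexity at most `k`
that appear before stage `t`. -/
def simpleSets (V : BinStr → ℕ → Option BinStr) (T : List Entry) (n k l t : ℕ) : List Entry :=
  (outputs V k t).filterMap (lookup T n l)

/-- The strings of complexity at most `q` in the first few simple sets of code `v`. -/
def simpleMembers (V : BinStr → ℕ → Option BinStr) (T : List Entry) (n k l m q : ℕ)
    (v : BinStr) (t : ℕ) : List BinStr :=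
  earlyMembers (simpleSets V T n k l t) (outputs V q t) (2 ^ (m + 1)) v

/-- The codes of the simple sets with at least `2 ^ h` members as in `simpleMembers`. -/
def heavyCodes (V : BinStr → ℕ → Option BinStr) (T : List Entry) (n k l m q h t : ℕ) :
    List BinStr :=
  ((simpleSets V T n k l t).map Prod.fst).filter fun v =>
    2 ^ h ≤ (simpleMembers V T n k l m q v t).length

/-- The codes of the sets picked from the blocks of `2 ^ d` simple sets. -/
def pickedCodes (V : BinStr → ℕ → Option BinStr) (T : List Entry) (n k l d t : ℕ) :
    List BinStr :=
  (picks (2 ^ d) (cubeList n) (simpleSets V T n k l t)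
    ((simpleSets V T n k l t).length / 2 ^ d)).map Prod.fst

section Primrec

variable {V : BinStr → ℕ → Option BinStr}
  {γ : Type*} [Primcodable γ] {T : γ → List Entry} {n k l m q h d t : γ → ℕ} {v : γ → BinStr}

theorem primrec_simpleSets (hV : Primrec₂ V) (hT : Primrec T) (hn : Primrec n) (hk : Primrec k)
    (hl : Primrec l) (ht : Primrec t) :
    Primrec fun c => simpleSets V (T c) (n c) (k c) (l c) (t c) :=
  Primrec.listFilterMap ((primrec_outputs hV).comp hk ht)
    (primrec_lookup (hT.comp Primrec.fst) (hn.comp Primrec.fst) (hl.comp Primrec.fst) Primrec.snd)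

theorem primrec_simpleMembers (hV : Primrec₂ V) (hT : Primrec T) (hn : Primrec n)
    (hk : Primrec k) (hl : Primrec l) (hm : Primrec m) (hq : Primrec q) (hv : Primrec v)
    (ht : Primrec t) : Primrec fun c =>
      simpleMembers V (T c) (n c) (k c) (l c) (m c) (q c) (v c) (t c) :=
  primrec_earlyMembers (primrec_simpleSets hV hT hn hk hl ht) ((primrec_outputs hV).comp hq ht)
    (primrec_nat_pow (Primrec.const 2) (Primrec.succ.comp hm)) hv

theorem primrec_heavyCodes (hV : Primrec₂ V) (hT : Primrec T) (hn : Primrec n)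
    (hk : Primrec k) (hl : Primrec l) (hm : Primrec m) (hq : Primrec q) (hh : Primrec h)
    (ht : Primrec t) : Primrec fun c =>
      heavyCodes V (T c) (n c) (k c) (l c) (m c) (q c) (h c) (t c) := by
  refine primrec_list_filter (Primrec.list_map (primrec_simpleSets hV hT hn hk hl ht)
    (Primrec.fst.comp Primrec.snd)) ?_
  exact (PrimrecRel.comp Primrec.nat_le
    (primrec_nat_pow (Primrec.const 2) (hh.comp Primrec.fst))
    (Primrec.list_length.comp (primrec_simpleMembers hV (hT.comp Primrec.fst)
      (hn.comp Primrec.fst) (hk.comp Primrec.fst) (hl.comp Primrec.fst) (hm.comp Primrec.fst)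
      (hq.comp Primrec.fst) Primrec.snd (ht.comp Primrec.fst)))).decide

theorem primrec_pickedCodes (hV : Primrec₂ V) (hT : Primrec T) (hn : Primrec n)
    (hk : Primrec k) (hl : Primrec l) (hd : Primrec d) (ht : Primrec t) : Primrec fun c =>
      pickedCodes V (T c) (n c) (k c) (l c) (d c) (t c) := by
  have hs := primrec_simpleSets hV hT hn hk hl ht
  have hD : Primrec fun c => 2 ^ d c := primrec_nat_pow (Primrec.const 2) hd
  exact Primrec.list_map (primrec_picks hD (primrec_cubeList.comp hn) hs
    (Primrec.nat_div.comp (Primrec.list_length.comp hs) hD)) (Primrec.fst.comp Primrec.snd)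

end Primrec

theorem exists_outputs_eventually {U : BinStr → BinStr →. BinStr} (hU : IsUniversalMachine U)
    {V : BinStr → ℕ → Option BinStr}
    (hV : ∀ p v, v ∈ U p [] ↔ ∃ t, V p t = some v) (k q : ℕ) :
    ∃ t₀, (∀ t, outputs V k t <+: outputs V k t₀) ∧ (∀ t, outputs V q t <+: outputs V q t₀) ∧
      (outputs V k t₀).length ≤ 2 ^ (k + 1) ∧ (outputs V q t₀).length ≤ 2 ^ (q + 1) ∧
      (∀ v, v ∈ outputs V k t₀ ↔ strC U v ≤ k) ∧ ∀ v, v ∈ outputs V q t₀ ↔ strC U v ≤ q := by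
  obtain ⟨t₁, h1, h1', h1''⟩ := exists_outputs_final hU hV k
  obtain ⟨t₂, h2, h2', h2''⟩ := exists_outputs_final hU hV q
  have e1 : outputs V k (max t₁ t₂) = outputs V k t₁ :=
    (h1 _).eq_of_length_le (accum_prefix _ (le_max_left _ _)).length_le
  have e2 : outputs V q (max t₁ t₂) = outputs V q t₂ :=
    (h2 _).eq_of_length_le (accum_prefix _ (le_max_right _ _)).length_le
  refine ⟨max t₁ t₂, ?_⟩
  rw [e1, e2]
  exact ⟨h1, h2, h1', h2', h1'', h2''⟩

variable {U : BinStr → BinStr →. BinStr} {φ : Finset BinStr → BinStr}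

/-- The parameters of the three descriptions. -/
noncomputable def paramList (a : BinStr) (n k l m q h d : ℕ) : List BinStr :=
  [a, binDigits n, binDigits k, binDigits l, binDigits m, binDigits q, binDigits h, binDigits d]

/-- The combinatorial form of the theorem: the bound holds up to the length of a description of
a few parameters. -/
theorem exists_setC_add_condSetC_le (hU : IsUniversalMachine U) (hφ : IsSetCoding φ)
    {𝒜 : Set (Finset BinStr)} (h𝒜 : IsDistortionFamily 𝒜) (h2 : Property2 𝒜) :
    ∃ c : ℕ, ∀ (x : BinStr), ∀ B ∈ 𝒜, x ∈ B → ∀ A, IsMinimalModel U φ 𝒜 x B A →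
      ∀ a : BinStr, φ ((restrict 𝒜 x.length).image φ) ∈ U a [] → ∀ r, x.length + 2 ≤ 2 ^ r →
      ∃ l m h d : ℕ, l ≤ x.length ∧ m ≤ setC U φ B + 1 ∧ h ≤ strC U x + m + 2 ∧ d ≤ m ∧
        setC U φ A + condSetC U φ x B ≤ strC U x + r +
          3 * (selfDelimList (paramList a x.length (setC U φ B) l m (strC U x) h d)).length
            + c := by
  obtain ⟨V', hV'prim, hV'⟩ := exists_primrec_stages hU.partrec
  let V : BinStr → ℕ → Option BinStr := fun p t => V' (p, []) t
  have hVprim : Primrec₂ V := hV'prim.comp (Primrec.fst.pair (Primrec.const [])) Primrec.snd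
  have hV : ∀ p v, v ∈ U p [] ↔ ∃ t, V p t = some v := fun p v => hV' (p, []) v
  have hT : Primrec fun p : Context × ℕ => p.1.2 := Primrec.snd.comp Primrec.fst
  have hp : ∀ i, Primrec fun p : Context × ℕ => contextParam p.1 i := fun i =>
    (primrec_param i).comp Primrec.fst
  have hy : Primrec fun p : Context × ℕ => p.1.1.2 :=
    Primrec.snd.comp (Primrec.fst.comp Primrec.fst)
  -- Here the code of the set is the auxiliary input; the next two enumerations are used with empty
  -- input.
  obtain ⟨c₁, hc₁⟩ := hU.exists_condC_le_of_enum (partrec_context hU hφ)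
    (L := fun z t => simpleMembers V z.2 (contextParam z 1) (contextParam z 2) (contextParam z 3) (contextParam z 4)
      (contextParam z 5) z.1.2 t)
    (primrec_simpleMembers hVprim hT (hp 1) (hp 2) (hp 3) (hp 4) (hp 5) hy Primrec.snd)
  obtain ⟨c₂, hc₂⟩ := hU.exists_condC_le_of_enum (partrec_context hU hφ)
    (L := fun z t => heavyCodes V z.2 (contextParam z 1) (contextParam z 2) (contextParam z 3) (contextParam z 4)
      (contextParam z 5) (contextParam z 6) t)
    (primrec_heavyCodes hVprim hT (hp 1) (hp 2) (hp 3) (hp 4) (hp 5) (hp 6) Primrec.snd)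
  obtain ⟨c₃, hc₃⟩ := hU.exists_condC_le_of_enum (partrec_context hU hφ)
    (L := fun z t => pickedCodes V z.2 (contextParam z 1) (contextParam z 2) (contextParam z 3) (contextParam z 7) t)
    (primrec_pickedCodes hVprim hT (hp 1) (hp 2) (hp 3) (hp 7) Primrec.snd)
  refine ⟨c₁ + c₂ + c₃ + 4, fun x B hB hxB A hA a ha r hr => ?_⟩
  set n := x.length with hn
  set k := setC U φ B with hk
  set q := strC U x with hq
  have hBn : B ∈ restrict 𝒜 n := mem_restrict.2 ⟨fun y hy => h2 B hB y hy x hxB, hB⟩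
  obtain ⟨T, hTmem, hTab⟩ := exists_findTable hφ (restrict 𝒜 n)
  have hcard : ∀ D ∈ T, cardIn n D = D.2.toFinset.card := fun D hD =>
    cardIn_eq fun y hy => (mem_restrict.1 (hTab.mem_family D hD)).1 y (List.mem_toFinset.2 hy)
  obtain ⟨E₀, hE₀, hE₀B⟩ := hTab.exists_mem B hBn
  obtain ⟨l, hl⟩ : ∃ l : ℕ, ceilLogCard B = l := by
    refine ⟨(ceilLogCard B).toNat, (Int.toNat_of_nonneg ?_).symm⟩
    refine Int.ceil_nonneg (Real.logb_nonneg (by norm_num) ?_)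
    exact_mod_cast (h𝒜 B hB).card_pos
  obtain ⟨hl1, hl2⟩ := (ceilLogCard_eq_iff (h𝒜 B hB) l).1 hl
  have hln : l ≤ n := by
    have h3 : B.card ≤ 2 ^ n := by
      rw [← hE₀B, ← hcard E₀ hE₀, ← length_cubeList]
      exact List.length_filter_le _ _
    have h4 : 2 ^ l < 2 ^ (n + 1) := by rw [pow_succ]; omega
    exact Nat.lt_succ_iff.1 ((Nat.pow_lt_pow_iff_right (by norm_num)).1 h4)
  -- The final stage `t₀` serves only to bound the enumerated sets. It is not computable and does
  -- not enter the parameters.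
  obtain ⟨t₀, hkpre, hqpre, hklen, hqlen, hkmem, hqmem⟩ := exists_outputs_eventually hU hV k q
  set K := simpleSets V T n k l t₀ with hK
  set S := outputs V q t₀ with hS
  have hKpre : ∀ t, simpleSets V T n k l t <+: K := fun t => (hkpre t).filterMap _
  have hKlen : K.length ≤ 2 ^ (k + 1) := (List.length_filterMap_le _ _).trans hklen
  have hKmem : ∀ D ∈ K, D ∈ T ∧ D.2.toFinset ∈ 𝒜 ∧ ceilLogCard D.2.toFinset = l := by
    intro D hD
    obtain ⟨v, -, hv⟩ := List.mem_filterMap.1 hD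
    obtain ⟨hDT, -, h3, h4⟩ := lookup_eq_some hv
    have hD𝒜 := (mem_restrict.1 (hTab.mem_family D hDT)).2
    rw [hcard D hDT] at h3 h4
    exact ⟨hDT, hD𝒜, (ceilLogCard_eq_iff (h𝒜 _ hD𝒜) l).2 ⟨h3, h4⟩⟩
  have hAle : ∀ D ∈ K, x ∈ D.2 → setC U φ A ≤ strC U D.1 := by
    intro D hD hxD
    obtain ⟨hDT, hD𝒜, hDl⟩ := hKmem D hD
    rw [hTab.code_eq D hDT]
    exact hA.2 _ hD𝒜 (List.mem_toFinset.2 hxD) (hDl.trans hl.symm)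
  -- The table may list `B` several times, so `lookup` may return an entry other than `E₀`; equal
  -- codes still mean equal sets.
  obtain ⟨E, hEK, hEcode, hxE⟩ : ∃ E ∈ K, E.1 = φ B ∧ x ∈ E.2 := by
    have h3 : cardIn n E₀ = B.card := by rw [hcard E₀ hE₀, hE₀B]
    obtain ⟨E, hE⟩ := exists_lookup_eq_some (l := l) hE₀ (by rwa [h3]) (by rwa [h3])
    have hE₀code : E₀.1 = φ B := by rw [hTab.code_eq E₀ hE₀, hE₀B]
    obtain ⟨hET, hEc, -, -⟩ := lookup_eq_some hE
    have hEK : E ∈ K := by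
      refine List.mem_filterMap.2 ⟨E₀.1, ?_, hE⟩
      rw [hE₀code]
      exact (hkmem _).2 le_rfl
    refine ⟨E, hEK, hEc.trans hE₀code, ?_⟩
    have : E.2.toFinset = B := by
      apply hφ.injective
      rw [← hTab.code_eq E hET, hEc, hE₀code]
    rw [← List.mem_toFinset, this]
    exact hxB
  set N := K.countP fun D => x ∈ D.2 with hN
  have hNpos : N ≠ 0 := by
    have : 0 < N := List.countP_pos_iff.2 ⟨E, hEK, by simpa using hxE⟩
    omega
  -- Fewer than 2^(m+1) sets contain `x`, so the cutoff discards none of them and `B` is early for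
  -- `x`.
  set m := Nat.log 2 N with hm
  have hm1 : 2 ^ m ≤ N := Nat.pow_log_le_self 2 hNpos
  have hm2 : N < 2 ^ (m + 1) := Nat.lt_pow_succ_log_self (by norm_num) N
  have hmk : m ≤ k + 1 := by
    have h3 : 2 ^ m ≤ 2 ^ (k + 1) := hm1.trans (List.countP_le_length.trans hKlen)
    exact (Nat.pow_le_pow_iff_right (by norm_num)).1 h3
  set M := simpleMembers V T n k l m q (φ B) t₀ with hM
  have hxM : x ∈ M := by
    refine List.mem_filter.2 ⟨(hqmem x).2 le_rfl, List.any_eq_true.2 ⟨E, ?_, by simpa using hEcode⟩⟩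
    rw [List.take_of_length_le]
    · exact List.mem_filter.2 ⟨hEK, by simpa using hxE⟩
    · rw [← List.countP_eq_length_filter]
      exact hm2.le
  have hMpos : M.length ≠ 0 := by
    have := List.length_pos_of_mem hxM
    omega
  set h := Nat.log 2 M.length with hh
  have hh1 : 2 ^ h ≤ M.length := Nat.pow_log_le_self 2 hMpos
  have hh2 : M.length < 2 ^ (h + 1) := Nat.lt_pow_succ_log_self (by norm_num) _
  set H := (heavyCodes V T n k l m q h t₀).toFinset with hH
  have hBH : φ B ∈ H := by
    refine List.mem_toFinset.2 (List.mem_filter.2 ⟨List.mem_map.2 ⟨E, hEK, hEcode⟩, ?_⟩)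
    simpa using hh1
  have hHcard : H.card * 2 ^ h ≤ 2 ^ (q + m + 2) := by
    refine (card_mul_le_of_le_length_earlyMembers K S (2 ^ (m + 1)) (2 ^ h) H ?_).trans ?_
    · intro v hv
      exact of_decide_eq_true (List.mem_filter.1 (List.mem_toFinset.1 hv)).2
    · calc S.length * 2 ^ (m + 1) ≤ 2 ^ (q + 1) * 2 ^ (m + 1) := Nat.mul_le_mul_right _ hqlen
        _ = 2 ^ (q + m + 2) := by ring
  have hhle : h ≤ q + m + 2 := by
    have h3 : 1 * 2 ^ h ≤ 2 ^ (q + m + 2) :=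
      (Nat.mul_le_mul_right _ (Finset.card_pos.2 ⟨_, hBH⟩)).trans hHcard
    rw [one_mul] at h3
    exact (Nat.pow_le_pow_iff_right (by norm_num)).1 h3
  -- Since n + 2 ≤ 2^r, this gives 2^d (n + 2) ≤ 2^m ≤ N when r ≤ m. If m < r the truncated value 0
  -- plays no role in the bound.
  set d := m - r with hd
  set us := paramList a n k l m q h d with hus
  refine ⟨l, m, h, d, hln, hmk, hhle, Nat.sub_le _ _, ?_⟩
  change _ ≤ q + r + 3 * (selfDelimList us).length + (c₁ + c₂ + c₃ + 4)
  have hctx : ∀ y, ((us, y), T) ∈ context U φ us y := fun y =>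
    Part.mem_bind (f := U (us.getD 0 []) []) ha (Part.mem_map _ hTmem)
  have hpar : ∀ y, contextParam ((us, y), T) 1 = n ∧ contextParam ((us, y), T) 2 = k ∧
      contextParam ((us, y), T) 3 = l ∧ contextParam ((us, y), T) 4 = m ∧
      contextParam ((us, y), T) 5 = q ∧ contextParam ((us, y), T) 6 = h ∧
      contextParam ((us, y), T) 7 = d := fun y =>
    ⟨strToNat_binDigits _, strToNat_binDigits _, strToNat_binDigits _, strToNat_binDigits _,
      strToNat_binDigits _, strToNat_binDigits _, strToNat_binDigits _⟩
  -- the string given the set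
  have hx : condSetC U φ x B ≤ h + 1 + (selfDelimList us).length + c₁ := by
    have key := hc₁ us (φ B) _ (hctx _)
    obtain ⟨e1, e2, e3, e4, e5, -, -⟩ := hpar (φ B)
    simp only [e1, e2, e3, e4, e5] at key
    refine key M.toFinset (h + 1) (fun t y hy => List.mem_toFinset.2 ?_)
      ((List.toFinset_card_le _).trans hh2.le) t₀ x hxM
    exact (earlyMembers_sublist (hKpre t) (hqpre t) _ _).subset hy
  -- the set among those with many members
  have hkle : k ≤ q + m + 2 - h + (selfDelimList us).length + c₂ := by
    have key := hc₂ us [] _ (hctx _)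
    obtain ⟨e1, e2, e3, e4, e5, e6, -⟩ := hpar []
    simp only [e1, e2, e3, e4, e5, e6] at key
    refine key H (q + m + 2 - h) (fun t v hv => List.mem_toFinset.2 ?_) ?_ t₀ (φ B)
      (List.mem_toFinset.1 hBH)
    · obtain ⟨hv1, hv2⟩ := List.mem_filter.1 hv
      refine List.mem_filter.2 ⟨((hKpre t).map _).subset hv1, ?_⟩
      simp only [decide_eq_true_eq] at hv2 ⊢
      exact hv2.trans (earlyMembers_sublist (hKpre t) (hqpre t) _ _).length_le
    · refine Nat.le_of_mul_le_mul_right (hHcard.trans_eq ?_) (by positivity : 0 < 2 ^ h)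
      rw [← pow_add, Nat.sub_add_cancel hhle]
  -- If m < r there is nothing to gain by thinning: minimality against `B` itself suffices, and the
  -- lost m is absorbed by r.
  rcases Nat.lt_or_ge m r with hmr | hmr
  · have : setC U φ A ≤ k := hA.2 B hB hxB rfl
    omega
  · -- a set picked from one of the blocks
    have hDN : 2 ^ d * (n + 2) ≤ N := by
      refine le_trans ?_ hm1
      calc 2 ^ d * (n + 2) ≤ 2 ^ d * 2 ^ r := Nat.mul_le_mul_left _ hr
        _ = 2 ^ m := by rw [← pow_add, hd, Nat.sub_add_cancel hmr]
    obtain ⟨D, hD, hxD⟩ := exists_mem_picks (by positivity : 0 < 2 ^ d) (length_cubeList n) K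
      ((mem_cubeList n x).2 rfl) hDN
    have hDle : strC U D.1 ≤ k + 1 - d + (selfDelimList us).length + c₃ := by
      have key := hc₃ us [] _ (hctx _)
      obtain ⟨e1, e2, e3, -, -, -, e7⟩ := hpar []
      simp only [e1, e2, e3, e7] at key
      refine key (pickedCodes V T n k l d t₀).toFinset (k + 1 - d)
        (fun t v hv => List.mem_toFinset.2 ?_) ?_ t₀ D.1 (List.mem_map.2 ⟨D, hD, rfl⟩)
      · obtain ⟨D', hD', rfl⟩ := List.mem_map.1 hv
        refine List.mem_map.2 ⟨D', ?_, rfl⟩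
        rw [picks_congr (hKpre t) (Nat.div_mul_le_self _ _)] at hD'
        exact picks_subset_of_le (Nat.div_le_div_right (hKpre t).length_le) hD'
      · refine (List.toFinset_card_le _).trans ?_
        rw [pickedCodes, List.length_map]
        refine (length_picks_le _ _ _ _).trans ?_
        rw [← hK]
        refine Nat.div_le_of_le_mul (hKlen.trans_eq ?_)
        rw [← pow_add]
        congr 1
        omega
    -- With C(A) about k - m + r, C(x | B) about h, and k about q + m - h at most, the sum leaves q
    -- + r.
    have := hAle D (picks_subset _ _ _ _ hD) hxD
    omega

end Descriptions

/-! ### Estimates for logarithms and binary lengths. -/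

section Logarithms

theorem natCast_le_two_rpow {v : ℕ} {Λ : ℝ} (h : Real.logb 2 v ≤ Λ) :
    (v : ℝ) ≤ 2 ^ Λ := by
  rcases Nat.eq_zero_or_pos v with rfl | hv
  · simp only [Nat.cast_zero]; positivity
  · exact (Real.logb_le_iff_le_rpow (by norm_num) (by exact_mod_cast hv)).1 h

theorem size_le_logb {v : ℕ} (hv : 0 < v) : (v.size : ℝ) ≤ Real.logb 2 v + 1 := by
  have hpos : 0 < v.size := Nat.size_pos.2 hv
  have h1 : 2 ^ (v.size - 1) ≤ v := Nat.lt_size.1 (by omega)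
  have h2 : ((v.size - 1 : ℕ) : ℝ) ≤ Real.logb 2 v := by
    rw [Real.le_logb_iff_rpow_le (by norm_num) (by exact_mod_cast hv), Real.rpow_natCast]
    exact_mod_cast h1
  rw [Nat.cast_sub (by omega)] at h2
  push_cast at h2
  linarith

theorem logb_natCast_nonneg (v : ℕ) : 0 ≤ Real.logb 2 (v : ℝ) := by
  rcases Nat.eq_zero_or_pos v with rfl | hv
  · simp
  · exact Real.logb_nonneg (by norm_num) (by exact_mod_cast hv)

end Logarithms

end RateDistortion

/-! ### The theorem with its logarithmic error term. -/

open RateDistortion in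
theorem theorem3
    (U : RateDistortion.BinStr → RateDistortion.BinStr →. RateDistortion.BinStr)
    (hU : RateDistortion.IsUniversalMachine U)
    (φ : Finset RateDistortion.BinStr → RateDistortion.BinStr)
    (hφ : RateDistortion.IsSetCoding φ)
    (𝒜 : Set (Finset RateDistortion.BinStr))
    (h𝒜 : RateDistortion.IsDistortionFamily 𝒜)
    (h2 : RateDistortion.Property2 𝒜)
    (h3 : RateDistortion.Property3 U φ 𝒜) :
    ∃ c : ℝ, ∀ (n : ℕ) (x : RateDistortion.BinStr), x.length = n →
      ∀ B ∈ 𝒜, x ∈ B →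
        ∀ A : Finset RateDistortion.BinStr, RateDistortion.IsMinimalModel U φ 𝒜 x B A →
          (RateDistortion.setC U φ A : ℝ) + Real.logb 2 (A.card : ℝ)
              - (RateDistortion.strC U x : ℝ)
            ≤ RateDistortion.deficiency U φ x B
              + (c * (Real.logb 2 (RateDistortion.setC U φ B : ℝ) + Real.logb 2 (n : ℝ)) + c) := by
  obtain ⟨c₀, hc₀⟩ := h3
  obtain ⟨c₁, hc₁⟩ := hU.exists_strC_le_length
  obtain ⟨c₂, hc₂⟩ := exists_setC_add_condSetC_le hU hφ h𝒜 h2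
  set κ : ℝ := Real.logb 2 (c₁ + 7) + 1
  have hκ : 1 ≤ κ := by
    have : 0 ≤ Real.logb 2 ((c₁ : ℝ) + 7) :=
      Real.logb_nonneg (by norm_num) (by have : (0 : ℝ) ≤ c₁ := Nat.cast_nonneg _; linarith)
    linarith
  have hc₂0 : (0 : ℝ) ≤ c₂ := Nat.cast_nonneg _
  -- Three copies of a parameter code of length 2|a| + 14 size(W) + 17, plus one size(W) for r, give
  -- the coefficients 6 and 43 and the summand 51; the rest of 60 is slack that also pays for
  -- rounding.
  refine ⟨6 * |c₀| + 43 * κ + c₂ + 60, fun n x hxn B hB hxB A hA => ?_⟩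
  subst hxn
  set n := x.length
  set k := setC U φ B
  set q := strC U x
  set Λ := Real.logb 2 (k : ℝ) + Real.logb 2 (n : ℝ)
  have hn0 := logb_natCast_nonneg n
  have hk0 := logb_natCast_nonneg k
  have hΛ : 0 ≤ Λ := add_nonneg hk0 hn0
  -- A common upper bound for all numerical parameters, using q ≤ n + c₁ and h ≤ q + m + 2; it also
  -- satisfies n + 2 ≤ 2^size(W).
  set W := n + k + c₁ + 5
  obtain ⟨a, halen, ha⟩ := hU.exists_program (φ ((restrict 𝒜 n).image φ)) []
  have hasize : (a.length : ℝ) ≤ |c₀| * Λ + |c₀| := by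
    have h4 : (a.length : ℝ) ≤ c₀ * Real.logb 2 (n : ℝ) + c₀ := by rw [halen]; exact hc₀ n
    have h5 : c₀ * Real.logb 2 (n : ℝ) ≤ |c₀| * Λ :=
      mul_le_mul (le_abs_self _) (by simp only [Λ]; linarith) hn0 (abs_nonneg _)
    linarith [le_abs_self c₀]
  have hW : (W.size : ℝ) ≤ Λ + κ := by
    have hn' : (n : ℝ) ≤ 2 ^ Λ := natCast_le_two_rpow (by simp only [Λ]; linarith)
    have hk' : (k : ℝ) ≤ 2 ^ Λ := natCast_le_two_rpow (by simp only [Λ]; linarith)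
    have h1' : (1 : ℝ) ≤ 2 ^ Λ := Real.one_le_rpow (by norm_num) hΛ
    have hc₁0 : (0 : ℝ) ≤ c₁ := Nat.cast_nonneg _
    have hWle : (W : ℝ) ≤ 2 ^ Λ * (c₁ + 7) := by
      simp only [W]; push_cast; nlinarith
    have hWpos : 0 < W := by omega
    have h4 : Real.logb 2 (W : ℝ) ≤ Λ + Real.logb 2 (c₁ + 7) := by
      refine (Real.logb_le_logb_of_le (by norm_num) (by exact_mod_cast hWpos) hWle).trans_eq ?_
      rw [Real.logb_mul (by positivity) (by positivity),
        Real.logb_rpow (by norm_num) (by norm_num)]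
    have h5 := size_le_logb hWpos
    simp only [κ]
    linarith
  obtain ⟨l, m, h, d, hl, hm, hh, hd, hmain⟩ := hc₂ x B hB hxB A hA a ha W.size (by
    have := Nat.lt_size_self W
    omega)
  have hq : q ≤ n + c₁ := hc₁ x
  have hsize : ∀ v, v ≤ W → v.size ≤ W.size := fun v hv => Nat.size_le_size hv
  have hlen : (selfDelimList (paramList a n k l m q h d)).length
      ≤ 2 * a.length + 14 * W.size + 17 := by
    rw [length_selfDelimList]
    simp only [paramList, List.map_cons, List.map_nil, List.sum_cons, List.sum_nil,
      length_binDigits]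
    have s1 := hsize n (by omega)
    have s2 := hsize k (by omega)
    have s3 := hsize l (by omega)
    have s4 := hsize m (by omega)
    have s5 := hsize q (by omega)
    have s6 := hsize h (by omega)
    have s7 := hsize d (by omega)
    omega
  have hmain' : setC U φ A + condSetC U φ x B ≤ q + W.size +
      3 * (selfDelimList (paramList a n k l m q h d)).length + c₂ := hmain
  have hnat : setC U φ A + condSetC U φ x B ≤ q + 6 * a.length + 43 * W.size + 51 + c₂ := by
    omega
  have hreal : (setC U φ A : ℝ) + condSetC U φ x B
      ≤ q + 6 * a.length + 43 * W.size + 51 + c₂ := by exact_mod_cast hnat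
  -- Equal rounded logarithms differ by at most 1 before rounding.
  have hlog : Real.logb 2 (A.card : ℝ) ≤ Real.logb 2 (B.card : ℝ) + 1 := by
    have h4 : Real.logb 2 (A.card : ℝ) ≤ (ceilLogCard A : ℝ) := Int.le_ceil _
    have h5 : (ceilLogCard B : ℝ) < Real.logb 2 (B.card : ℝ) + 1 := Int.ceil_lt_add_one _
    rw [hA.1.2.2] at h4
    linarith
  simp only [deficiency]
  have hfin : 6 * (|c₀| * Λ + |c₀|) + 43 * (Λ + κ) + 52 + c₂
      ≤ (6 * |c₀| + 43 * κ + c₂ + 60) * Λ + (6 * |c₀| + 43 * κ + c₂ + 60) := by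
    nlinarith [mul_nonneg (sub_nonneg.2 hκ) hΛ, mul_nonneg hc₂0 hΛ]
  linarith
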